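/- Throughout, $\log$ is the logarithm to base $2$ and $\ln$ the natural logarithm. A state is a positive semidefinite complex $n\times n$ matrix of trace $1$ ($n$ arbitrary, finite). For states $\rho,\sigma$ of the same dimension let $T(\rho,\sigma)=\tfrac12\operatorname{tr}|\rho-\sigma|$ be the trace distance and let $D(\rho\|\sigma)=\operatorname{tr}(\rho\log\rho-\rho\log\sigma)$ be the Umegaki divergence, with $0\log 0=0$ and $D(\rho\|\sigma)=+\infty$ unless $\ker\sigma\subseteq\ker\rho$. For $r,s\in[0,1]$ write $D_{\rm bin}(r\|s)=D(\operatorname{diag}(r,1-r)\,\|\,\operatorname{diag}(s,1-s))$. Define the optimal linear and convex lower bounds $$L_D(\lambda)=\inf_{n,\rho,\sigma}\{D(\rho\|\sigma)-\lambda T(\rho,\sigma)\},\qquad B_D(T)=\sup_{\lambda\in\mathbb R}\{L_D(\lambda)+\lambda T\}.$$ For $\lambda>0$ put $$r^*(\lambda)=\frac{2^\lambda(2^\lambda-1-\lambda\ln 2)}{(2^\lambda-1)^2},\qquad s^*(\lambda)=\frac1{1-2^\lambda}+\frac1{\lambda\ln 2},$$ and for $t>0$ put $$T(t)=\frac{(2^t-1-\ln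 2^t)(1-2^t+2^t\ln 2^t)}{(2^t-1)^2\ln 2^t},$$ $$D(t)=\frac{1-2^t+2^t\ln 2^t}{(2^t-1)^2}\log\frac{t}{2^t-1}-2^t\,\frac{1-2^t+\ln 2^t}{(2^t-1)^2}\log\frac{2^t t}{2^t-1}+\log(\ln 2).$$ As the argument tends to $0^+$ these functions have the limits $r^*(0)=s^*(0)=\tfrac12$ and $T(0)=D(0)=0$, which are taken as their values at $0$. Then the following hold. 1. (Linear bound.) For all $0\le\lambda<\infty$, $$L_D(\lambda)=\log\!\left(\Big(\frac{r^*}{s^*}\Big)^{r^*}\Big(\frac{1-r^*}{1-s^*}\Big)^{1-r^*}\right)-\lambda(r^*-s^*),\qquad r^*=r^*(\lambda),\ s^*=s^*(\lambda),$$ and $L_D(\lambda)\to-\infty$ as $\lambda\to\infty$. Here $0<s^*\le r^*<1$, and this value equals $D_{\rm bin}(r^*\|s^*)-\lambda(r^*-s^*)$. For $\lambda>0$ one has $s^*<r^*$, and $(r^*,s^*)$ is the unique minimizer of $(r,s)\mapsto D_{\rm bin}(r\|s)-\lambda(r-s)$ on $[0,1]^2$. 2. (Convex bound.) The map $t\mapsto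 T(t)$ is a bijection from $[0,\infty)$ onto $[0,1)$, and $B_D(T(t))=D(t)$ for all $t\ge0$; so the graph of $B_D$ over $[0,1)$ is the curve $(T(t),D(t))$, $t\ge 0$. The point $(T(t),D(t))$ is the pair (trace distance, divergence) of the states $\operatorname{diag}(r^*(t),1-r^*(t))$ and $\operatorname{diag}(s^*(t),1-s^*(t))$. For all states, $D(\rho\|\sigma)\ge B_D(T(\rho,\sigma))$. The function $B_D$ is convex on $[0,1)$. The bound is optimal: for every $T\in[0,1]$, $B_D(T)$ is the minimum of $D(\rho\|\sigma)$ over all pairs of states (of any finite dimension) with $T(\rho,\sigma)=T$. 3. (Comparison with Pinsker.) $B_D(T)>\frac{2}{\ln 2}T^2$ for all $0<T\le1$. Moreover $B_D(T)<\infty$ for $0\le T<1$, while $B_D(T)\to\infty$ as $T\to1^-$ and $B_D(1)=\infty$. -/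

import Mathlib

open Set Filter Topology
open scoped MatrixOrder ComplexOrder

noncomputable section

/-- `ρ` is a state (density operator) on the Hilbert space `ℂⁿ`. -/
def IsState {n : ℕ} (ρ : Matrix (Fin n) (Fin n) ℂ) : Prop :=
  ρ.PosSemidef ∧ ρ.trace = 1

/-- The trace distance `½ tr |ρ - σ|`. -/
def traceDist {n : ℕ} (ρ σ : Matrix (Fin n) (Fin n) ℂ) : ℝ :=
  (1 / 2) * (CFC.abs (ρ - σ)).trace.re

open Classical in
/-- The Umegaki divergence `tr (ρ log ρ - ρ log σ)` with the logarithm to base 2. It is `+∞` unless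
the support of `ρ` lies in that of `σ`, that is, unless `ker σ ⊆ ker ρ`. The functional calculus
uses `log 0 = 0`, which realizes the usual convention `0 log 0 = 0`: on `ker ρ`, and on
`ker σ ⊆ ker ρ`, the factor `ρ` vanishes. -/
def umegakiDiv {n : ℕ} (ρ σ : Matrix (Fin n) (Fin n) ℂ) : EReal :=
  if ∀ v : Fin n → ℂ, σ.mulVec v = 0 → ρ.mulVec v = 0 then
    (((ρ * cfc (Real.logb 2) ρ - ρ * cfc (Real.logb 2) σ).trace.re : ℝ) : EReal)
  else ⊤

/-- The optimal linear lower bound `L_D(lam) = inf {D(ρ‖σ) - lam T(ρ, σ)}`, over all pairs of states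
of all finite dimensions. -/
def umegakiLinearBound (lam : ℝ) : EReal :=
  ⨅ (n : ℕ) (ρ : Matrix (Fin n) (Fin n) ℂ) (σ : Matrix (Fin n) (Fin n) ℂ)
    (_ : IsState ρ) (_ : IsState σ), umegakiDiv ρ σ - ((lam * traceDist ρ σ : ℝ) : EReal)

/-- The optimal convex lower bound `B_D(T) = sup_lam {L_D(lam) + lam T}`. -/
def umegakiConvexBound (T : ℝ) : EReal :=
  ⨆ lam : ℝ, umegakiLinearBound lam + ((lam * T : ℝ) : EReal)

/-- The binary classical state `diag (r, 1 - r)`. -/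
def binaryState (r : ℝ) : Matrix (Fin 2) (Fin 2) ℂ :=
  Matrix.diagonal ![(r : ℂ), ((1 - r : ℝ) : ℂ)]

/-- The binary version of the Umegaki divergence. -/
def umegakiBin (r s : ℝ) : EReal :=
  umegakiDiv (binaryState r) (binaryState s)

/-- First coordinate of the minimizer, extended to `lam = 0` by its limit. -/
def rStar (lam : ℝ) : ℝ :=
  if lam = 0 then 1 / 2 else
    (2 : ℝ) ^ lam * ((2 : ℝ) ^ lam - 1 - lam * Real.log 2) / ((2 : ℝ) ^ lam - 1) ^ 2

/-- Second coordinate of the minimizer, extended to `lam = 0` by its limit. -/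
def sStar (lam : ℝ) : ℝ :=
  if lam = 0 then 1 / 2 else
    1 / (1 - (2 : ℝ) ^ lam) + 1 / (lam * Real.log 2)

/-- First coordinate `T(t)` of the parametrized curve, extended to `t = 0` by its limit. -/
def curveT (t : ℝ) : ℝ :=
  if t = 0 then 0 else
    (((2 : ℝ) ^ t - 1 - Real.log ((2 : ℝ) ^ t)) *
      (1 - (2 : ℝ) ^ t + (2 : ℝ) ^ t * Real.log ((2 : ℝ) ^ t))) /
      (((2 : ℝ) ^ t - 1) ^ 2 * Real.log ((2 : ℝ) ^ t))

/-- Second coordinate `D(t)` of the parametrized curve, extended to `t = 0` by its limit. -/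
def curveD (t : ℝ) : ℝ :=
  if t = 0 then 0 else
    (1 - (2 : ℝ) ^ t + (2 : ℝ) ^ t * Real.log ((2 : ℝ) ^ t)) / ((2 : ℝ) ^ t - 1) ^ 2 *
        Real.logb 2 (t / ((2 : ℝ) ^ t - 1))
      - (2 : ℝ) ^ t * ((1 - (2 : ℝ) ^ t + Real.log ((2 : ℝ) ^ t)) / ((2 : ℝ) ^ t - 1) ^ 2) *
        Real.logb 2 ((2 : ℝ) ^ t * t / ((2 : ℝ) ^ t - 1))
      + Real.logb 2 (Real.log 2)

end

namespace Umegaki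

section

open Matrix

/-! ### Traces in eigenbases -/

variable {n : ℕ}

/-! The problem reduces to two real parameters. Measuring `ρ` and `σ` with the projection `P` onto
the nonnegative part of `ρ - σ` preserves the trace distance and cannot increase the divergence, so
binary distributions suffice (`exists_umegakiBin_le`).

Monotonicity comes from resolvents. In the two eigenbases the divergence is a sum over pairs of
eigenvectors weighted by overlaps; up to a logarithm depending only on the total mass, it is the
integral over `s > 0` of the sums `∑ w p² / (q + s p)`. Each such sum dominates `2 tr ρY - tr σY² -
s tr ρY²` for Hermitian `Y`, and a suitable `Y` in the span of `P` and `1 - P` turns this into the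
binary resolvent sum (`two_mul_trace_sub_le`, `sum_mul_log_sub_log_le`, `klBin_trace_le`).

For binary distributions put `a = λ ln 2`. Tilting `(s, 1 - s)` by `eᵃ` splits the objective into a
divergence from the tilted distribution and a function of `s` alone. Gibbs' inequality and `log x ≤
x - 1` minimize these, with a unique explicit minimizer (`le_klBin_sub`). Hence the line of slope
`t` through `(T(t), D(t))` is the optimal one of that slope, so the curve is the graph of the convex
bound and is attained by states. Uniqueness of the minimizer makes `T` injective; continuity and its
limits make it surjective. Pinsker's bound is then needed only strictly inside the binary square. -/

theorem trace_diagonal_mul_conj (x y : Fin n → ℝ) (Z : Matrix (Fin n) (Fin n) ℂ) :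
    (diagonal (fun i => (y i : ℂ)) * Z * diagonal (fun i => (x i : ℂ)) * Zᴴ).trace.re =
      ∑ b, ∑ a, y b * x a * Complex.normSq (Z b a) := by
  simp only [trace, diag_apply, mul_apply (N := Zᴴ), mul_diagonal, diagonal_mul, conjTranspose_apply,
    Complex.re_sum, Complex.normSq_apply]
  refine Finset.sum_congr rfl fun b _ => Finset.sum_congr rfl fun a _ => ?_
  simp
  ring

theorem trace_diagonal_mul_inner (x : Fin n → ℝ) (Z W : Matrix (Fin n) (Fin n) ℂ) :
    (diagonal (fun i => (x i : ℂ)) * (Zᴴ * W)).trace.re =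
      ∑ b, ∑ a, x a * ((Z b a).re * (W b a).re + (Z b a).im * (W b a).im) := by
  rw [Finset.sum_comm]
  simp only [trace, diag_apply, diagonal_mul, mul_apply (M := Zᴴ), conjTranspose_apply, Complex.re_sum,
    Finset.mul_sum]
  refine Finset.sum_congr rfl fun b _ => Finset.sum_congr rfl fun a _ => ?_
  simp

theorem cfc_eq_conj {A : Matrix (Fin n) (Fin n) ℂ} (hA : A.IsHermitian) (f : ℝ → ℝ) :
    cfc f A = (hA.eigenvectorUnitary : Matrix (Fin n) (Fin n) ℂ) *
      diagonal (fun i => (f (hA.eigenvalues i) : ℂ)) *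
        (hA.eigenvectorUnitary : Matrix (Fin n) (Fin n) ℂ)ᴴ := by
  rw [hA.cfc_eq, Matrix.IsHermitian.cfc, Unitary.conjStarAlgAut_apply]
  rfl

/-- The overlaps `|⟨b|a⟩|²` of the eigenvectors `b` of `B` with the eigenvectors `a` of `A`. -/
noncomputable def overlap {A B : Matrix (Fin n) (Fin n) ℂ} (hA : A.IsHermitian)
    (hB : B.IsHermitian) (b a : Fin n) : ℝ :=
  Complex.normSq (((hB.eigenvectorUnitary : Matrix (Fin n) (Fin n) ℂ)ᴴ *
    (hA.eigenvectorUnitary : Matrix (Fin n) (Fin n) ℂ)) b a)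

theorem overlap_nonneg {A B : Matrix (Fin n) (Fin n) ℂ} (hA : A.IsHermitian)
    (hB : B.IsHermitian) (b a : Fin n) : 0 ≤ overlap hA hB b a := Complex.normSq_nonneg _

theorem trace_cfc_mul_cfc {A B : Matrix (Fin n) (Fin n) ℂ} (hA : A.IsHermitian)
    (hB : B.IsHermitian) (f g : ℝ → ℝ) :
    (cfc f A * cfc g B).trace.re =
      ∑ b, ∑ a, g (hB.eigenvalues b) * f (hA.eigenvalues a) * overlap hA hB b a := by
  have h := trace_diagonal_mul_conj (fun a => f (hA.eigenvalues a))
    (fun b => g (hB.eigenvalues b)) ((hB.eigenvectorUnitary : Matrix (Fin n) (Fin n) ℂ)ᴴ *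
      (hA.eigenvectorUnitary : Matrix (Fin n) (Fin n) ℂ))
  unfold overlap
  rw [← h, cfc_eq_conj hA, cfc_eq_conj hB, conjTranspose_mul, conjTranspose_conjTranspose]
  generalize (hA.eigenvectorUnitary : Matrix (Fin n) (Fin n) ℂ) = U
  generalize (hB.eigenvectorUnitary : Matrix (Fin n) (Fin n) ℂ) = V
  congr 1
  rw [trace_mul_comm]
  simp only [Matrix.mul_assoc]
  rw [trace_mul_comm V]
  simp only [Matrix.mul_assoc]

theorem unitary_mul_conjTranspose {A : Matrix (Fin n) (Fin n) ℂ} (hA : A.IsHermitian) :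
    (hA.eigenvectorUnitary : Matrix (Fin n) (Fin n) ℂ) *
      (hA.eigenvectorUnitary : Matrix (Fin n) (Fin n) ℂ)ᴴ = 1 :=
  Unitary.mul_star_self_of_mem hA.eigenvectorUnitary.2

theorem eq_conj {A : Matrix (Fin n) (Fin n) ℂ} (hA : A.IsHermitian) :
    A = (hA.eigenvectorUnitary : Matrix (Fin n) (Fin n) ℂ) *
      diagonal (fun i => (hA.eigenvalues i : ℂ)) *
        (hA.eigenvectorUnitary : Matrix (Fin n) (Fin n) ℂ)ᴴ := by
  conv_lhs => rw [hA.spectral_theorem, Unitary.conjStarAlgAut_apply]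
  rfl

/-- Completing the square in every entry bounds a resolvent of the relative modular operator. -/
theorem two_mul_trace_sub_le {A B Y : Matrix (Fin n) (Fin n) ℂ} (hA : A.PosSemidef)
    (hB : B.PosSemidef) (hY : Yᴴ = Y) {s : ℝ} (hs : 0 < s) :
    2 * (A * Y).trace.re - ((B * (Y * Y)).trace.re + s * (A * (Y * Y)).trace.re) ≤
      ∑ b, ∑ a, overlap hA.1 hB.1 b a * hA.1.eigenvalues a ^ 2 /
        (hB.1.eigenvalues b + s * hA.1.eigenvalues a) := by
  set U := (hA.1.eigenvectorUnitary : Matrix (Fin n) (Fin n) ℂ) with hU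
  set V := (hB.1.eigenvectorUnitary : Matrix (Fin n) (Fin n) ℂ) with hV
  set p := hA.1.eigenvalues with hp
  set q := hB.1.eigenvalues with hq
  have hUU : U * Uᴴ = 1 := unitary_mul_conjTranspose hA.1
  have hVV : V * Vᴴ = 1 := unitary_mul_conjTranspose hB.1
  -- The matrix of `Y` between the two eigenbases: in its entries all three traces become double
  -- sums, and the claim decouples into one inequality per entry.
  set Z := Vᴴ * Y * U with hZ
  have hZ' : Zᴴ = Uᴴ * Y * V := by
    simp [hZ, conjTranspose_mul, hY, Matrix.mul_assoc]
  have hAe : A = U * diagonal (fun i => (p i : ℂ)) * Uᴴ := eq_conj hA.1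
  have hBe : B = V * diagonal (fun i => (q i : ℂ)) * Vᴴ := eq_conj hB.1
  have one : (diagonal (fun _ => ((1 : ℝ) : ℂ)) : Matrix (Fin n) (Fin n) ℂ) = 1 := by simp
  have e1 : (A * Y).trace.re =
      ∑ b, ∑ a, p a * ((Z b a).re * ((Vᴴ * U) b a).re + (Z b a).im * ((Vᴴ * U) b a).im) := by
    rw [← trace_diagonal_mul_inner, hZ']
    congr 1
    have : Uᴴ * Y * V * (Vᴴ * U) = Uᴴ * Y * U := by
      rw [Matrix.mul_assoc, ← Matrix.mul_assoc V, hVV, Matrix.one_mul]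
    rw [this, hAe, Matrix.mul_assoc, Matrix.mul_assoc, trace_mul_comm]
    simp only [Matrix.mul_assoc]
  have e2 : (B * (Y * Y)).trace.re = ∑ b, ∑ a, q b * 1 * Complex.normSq (Z b a) := by
    rw [← trace_diagonal_mul_conj (fun _ => 1), one, Matrix.mul_one, hZ', hZ]
    congr 1
    have : diagonal (fun i => (q i : ℂ)) * (Vᴴ * Y * U) * (Uᴴ * Y * V) =
        diagonal (fun i => (q i : ℂ)) * Vᴴ * (Y * Y) * V := by
      calc _ = diagonal (fun i => (q i : ℂ)) * Vᴴ * Y * (U * Uᴴ) * Y * V := by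
            simp only [Matrix.mul_assoc]
        _ = _ := by rw [hUU, Matrix.mul_one]; simp only [Matrix.mul_assoc]
    rw [this, trace_mul_comm _ V, hBe]
    simp only [Matrix.mul_assoc]
  have e3 : (A * (Y * Y)).trace.re = ∑ b, ∑ a, 1 * p a * Complex.normSq (Z b a) := by
    rw [← trace_diagonal_mul_conj p (fun _ => 1), one, Matrix.one_mul, hZ', hZ]
    congr 1
    have : Vᴴ * Y * U * diagonal (fun i => (p i : ℂ)) * (Uᴴ * Y * V) =
        Vᴴ * (Y * A * Y * V) := by
      rw [hAe]; simp only [Matrix.mul_assoc]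
    rw [this, trace_mul_comm Vᴴ, Matrix.mul_assoc _ V, hVV, Matrix.mul_one, Matrix.mul_assoc,
      trace_mul_comm Y, Matrix.mul_assoc]
  rw [e1, e2, e3, Finset.mul_sum, Finset.mul_sum, ← Finset.sum_add_distrib,
    ← Finset.sum_sub_distrib]
  refine Finset.sum_le_sum fun b _ => ?_
  rw [Finset.mul_sum, Finset.mul_sum, ← Finset.sum_add_distrib, ← Finset.sum_sub_distrib]
  refine Finset.sum_le_sum fun a _ => ?_
  have hpa : 0 ≤ p a := hA.eigenvalues_nonneg a
  have hqb : 0 ≤ q b := hB.eigenvalues_nonneg b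
  rw [show overlap hA.1 hB.1 b a = Complex.normSq ((Vᴴ * U) b a) from rfl]
  generalize (Vᴴ * U) b a = w
  generalize Z b a = z
  rw [Complex.normSq_apply, Complex.normSq_apply]
  -- If `p a = 0` the denominator may vanish, but the right side is `0` and the left side is `-q b *
  -- |z|²`.
  rcases hpa.eq_or_lt with h0 | h0
  · rw [← h0]
    have := mul_nonneg hqb (add_nonneg (mul_self_nonneg z.re) (mul_self_nonneg z.im))
    simp only [zero_mul, mul_zero, ne_eq, OfNat.ofNat_ne_zero, not_false_eq_true, zero_pow,
      zero_div, mul_one, add_zero]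
    linarith
  · have hd : 0 < q b + s * p a := by positivity
    rw [le_div_iff₀ hd]
    nlinarith [sq_nonneg ((q b + s * p a) * z.re - p a * w.re),
      sq_nonneg ((q b + s * p a) * z.im - p a * w.im)]

end

section

/-! ### Comparison of logarithmic sums through their resolvents -/

/-- The sum `∑ wₖ pₖ log (qₖ + s pₖ)`. -/
noncomputable def logSum {ι : Type*} [Fintype ι] (w p q : ι → ℝ) (s : ℝ) : ℝ :=
  ∑ k, w k * p k * Real.log (q k + s * p k)

variable {ι κ : Type*} [Fintype ι] [Fintype κ]

/-- The derivative is exactly the resolvent sum. A zero `p k` removes its term, and otherwise `s >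
0` keeps the logarithm away from `0`, so `q k` may vanish. -/
theorem hasDerivAt_logSum {w p q : ι → ℝ} (hp : ∀ k, 0 ≤ p k)
    (hq : ∀ k, 0 ≤ q k) {s : ℝ} (hs : 0 < s) :
    HasDerivAt (logSum w p q) (∑ k, w k * p k ^ 2 / (q k + s * p k)) s := by
  unfold logSum
  refine HasDerivAt.fun_sum fun k _ => ?_
  rcases (hp k).eq_or_lt with h0 | h0
  · simpa [← h0] using hasDerivAt_const s (0 : ℝ)
  · have hd : 0 < q k + s * p k := by have := hq k; positivity
    have h1 : HasDerivAt (fun s => q k + s * p k) (p k) s := by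
      simpa using ((hasDerivAt_id s).mul_const (p k)).const_add (q k)
    have h2 := (h1.log hd.ne').const_mul (w k * p k)
    rwa [show w k * p k * (p k / (q k + s * p k)) = w k * p k ^ 2 / (q k + s * p k) by ring] at h2

/-- At `s = 0` the support condition is essential: with `log 0 = 0`, a surviving term with `q k = 0`
would jump there. -/
theorem continuousOn_logSum {w p q : ι → ℝ} (hp : ∀ k, 0 ≤ p k)
    (hq : ∀ k, 0 ≤ q k) (h0 : ∀ k, w k * p k ≠ 0 → q k ≠ 0) :
    ContinuousOn (logSum w p q) (Ici 0) := by
  refine continuousOn_finsetSum _ fun k _ => ?_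
  by_cases hk : w k * p k = 0
  · simp only [hk, zero_mul]; exact continuousOn_const
  · have : 0 < q k := lt_of_le_of_ne (hq k) (Ne.symm (h0 k hk))
    refine continuousOn_const.mul (ContinuousOn.log (by fun_prop) fun s hs => ?_)
    have := mul_nonneg (mem_Ici.1 hs) (hp k)
    positivity

/-- Subtracting the mass times `log s` divides each argument by `s`, and `q k / s + p k` tends to `p
k`. -/
theorem tendsto_logSum_sub {w p q : ι → ℝ} (hp : ∀ k, 0 ≤ p k) (hq : ∀ k, 0 ≤ q k) :
    Tendsto (fun s => logSum w p q s - (∑ k, w k * p k) * Real.log s) atTop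
      (𝓝 (∑ k, w k * p k * Real.log (p k))) := by
  have h : ∀ k, Tendsto (fun s : ℝ => w k * p k * Real.log (q k * s⁻¹ + p k)) atTop
      (𝓝 (w k * p k * Real.log (p k))) := by
    intro k
    rcases (hp k).eq_or_lt with h0 | h0
    · simp [← h0]
    · have h1 : Tendsto (fun s : ℝ => q k * s⁻¹ + p k) atTop (𝓝 (q k * 0 + p k)) :=
        (tendsto_inv_atTop_zero.const_mul _).add_const _
      rw [mul_zero, zero_add] at h1
      exact (h1.log h0.ne').const_mul _
  refine (tendsto_finsetSum Finset.univ fun k _ => h k).congr' ?_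
  filter_upwards [eventually_gt_atTop 0] with s hs
  rw [logSum, Finset.sum_mul, ← Finset.sum_sub_distrib]
  refine Finset.sum_congr rfl fun k _ => ?_
  rcases (hp k).eq_or_lt with h0 | h0
  · simp [← h0]
  · have hd : 0 < q k * s⁻¹ + p k := by have := hq k; positivity
    rw [← mul_sub, ← Real.log_div (by have := hq k; positivity) hs.ne']
    congr 2
    field_simp

/-- If the resolvent sums of one family dominate those of another one with the same mass, then so
do the negated logarithmic divergences. -/
theorem sum_mul_log_sub_log_le {w p q : ι → ℝ} {v x y : κ → ℝ} (hp : ∀ k, 0 ≤ p k)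
    (hq : ∀ k, 0 ≤ q k) (hx : ∀ k, 0 ≤ x k) (hy : ∀ k, 0 ≤ y k)
    (hpq : ∀ k, w k * p k ≠ 0 → q k ≠ 0) (hxy : ∀ k, v k * x k ≠ 0 → y k ≠ 0)
    (hm : ∑ k, w k * p k = ∑ k, v k * x k)
    (h : ∀ s, 0 < s → ∑ k, v k * x k ^ 2 / (y k + s * x k) ≤
      ∑ k, w k * p k ^ 2 / (q k + s * p k)) :
    ∑ k, v k * x k * (Real.log (x k) - Real.log (y k)) ≤
      ∑ k, w k * p k * (Real.log (p k) - Real.log (q k)) := by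
  -- The difference increases from `s = 0`, where it contains the `log q` and `log y` terms, to
  -- infinity, where equal masses cancel `log s` and the `log p` and `log x` terms remain.
  have mono : MonotoneOn (fun s => logSum w p q s - logSum v x y s) (Ici 0) := by
    refine monotoneOn_of_deriv_nonneg (convex_Ici 0)
      ((continuousOn_logSum hp hq hpq).sub (continuousOn_logSum hx hy hxy)) ?_ ?_
    · intro s hs
      rw [interior_Ici] at hs
      exact ((hasDerivAt_logSum hp hq hs).sub
        (hasDerivAt_logSum hx hy hs)).differentiableAt.differentiableWithinAt
    · intro s hs
      rw [interior_Ici] at hs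
      have := ((hasDerivAt_logSum (w := w) hp hq hs).sub (hasDerivAt_logSum (w := v) hx hy hs)).deriv
      have h2 := h s hs
      exact (sub_nonneg.2 h2).trans_eq this.symm
  have lim := (tendsto_logSum_sub (w := w) hp hq).sub (tendsto_logSum_sub (w := v) hx hy)
  have key := ge_of_tendsto lim (b := logSum w p q 0 - logSum v x y 0) <| by
    filter_upwards [eventually_ge_atTop 0] with s hs
    have := mono (mem_Ici.2 le_rfl) (mem_Ici.2 hs) hs
    simp only at this
    rw [hm]
    linarith
  simp only [logSum, zero_mul, add_zero] at key
  simp only [mul_sub, Finset.sum_sub_distrib]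
  linarith

end

section

open Matrix

variable {n : ℕ}

/-! ### Monotonicity under two-outcome measurements -/

theorem continuousOn_spectrum (A : Matrix (Fin n) (Fin n) ℂ) (f : ℝ → ℝ) :
    ContinuousOn f (spectrum ℝ A) :=
  (Matrix.finite_real_spectrum (A := A)).continuousOn f

theorem cfc_id_eq {A : Matrix (Fin n) (Fin n) ℂ} (hA : A.IsHermitian) :
    cfc (fun x : ℝ => x) A = A :=
  cfc_id' ℝ A (ha := hA.isSelfAdjoint)

/-- With `e` the indicator of `[0, ∞)`, `|A| = 2 A e(A) - A`, and `A = ρ - σ` has trace zero. -/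
theorem exists_projection_traceDist {ρ σ : Matrix (Fin n) (Fin n) ℂ} (hρ : IsState ρ)
    (hσ : IsState σ) : ∃ P : Matrix (Fin n) (Fin n) ℂ, Pᴴ = P ∧ P * P = P ∧
      traceDist ρ σ = (ρ * P).trace.re - (σ * P).trace.re := by
  set A := ρ - σ with hA
  have hAh : A.IsHermitian := hρ.1.1.sub hσ.1.1
  have hAs : IsSelfAdjoint A := hAh
  have hc := continuousOn_spectrum A
  let e : ℝ → ℝ := fun x => if 0 ≤ x then 1 else 0
  refine ⟨cfc e A, (cfc_predicate e A : IsSelfAdjoint _), ?_, ?_⟩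
  · rw [← cfc_mul e e A (hc _) (hc _)]
    congr 1
    ext x
    by_cases h : 0 ≤ x <;> simp [e, h]
  · have habs : CFC.abs A = cfc (fun x : ℝ => |x|) A := by
      simpa using CFC.abs_eq_cfc_norm A (ha := hAs)
    have h1 : cfc (fun x : ℝ => |x|) A = A * cfc e A + A * cfc e A - A := by
      have h2 : A * cfc e A = cfc (fun x => x * e x) A := by
        rw [cfc_mul (fun x => x) e A (hc _) (hc _), cfc_id' ℝ A]
      have h3 : cfc (fun x : ℝ => (x * e x + x * e x) - x) A =
          A * cfc e A + A * cfc e A - A := by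
        rw [cfc_sub (fun x : ℝ => x * e x + x * e x) (fun x => x) A (hc _) (hc _),
          cfc_add A (fun x => x * e x) (fun x => x * e x) (hc _) (hc _), cfc_id' ℝ A, h2]
      rw [← h3]
      congr 1
      ext x
      by_cases h : 0 ≤ x
      · simp [e, h, abs_of_nonneg]
      · simp [e, h, abs_of_neg (not_le.1 h)]
    rw [traceDist, ← hA, habs, h1, trace_sub, trace_add, hA, Matrix.sub_mul, trace_sub, trace_sub,
      hρ.2, hσ.2]
    simp
    ring

theorem trace_conj_nonneg {A P : Matrix (Fin n) (Fin n) ℂ} (hA : A.PosSemidef) (hP : Pᴴ = P)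
    (hPP : P * P = P) : 0 ≤ (A * P).trace.re := by
  have h := (hA.mul_mul_conjTranspose_same P).trace_nonneg
  rw [hP, trace_mul_comm, ← Matrix.mul_assoc, hPP, trace_mul_comm] at h
  exact (Complex.nonneg_iff.1 h).1

/-- The positive matrix `P B P` has trace zero, hence vanishes; so the range of `P` lies in `ker B`,
and therefore in `ker A`. -/
theorem trace_mul_projection_eq_zero {A B P : Matrix (Fin n) (Fin n) ℂ} (hB : B.PosSemidef)
    (hP : Pᴴ = P) (hPP : P * P = P)
    (hker : ∀ v : Fin n → ℂ, B.mulVec v = 0 → A.mulVec v = 0) (h0 : (B * P).trace.re = 0) :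
    (A * P).trace.re = 0 := by
  have h := hB.mul_mul_conjTranspose_same P
  have ht : (P * B * Pᴴ).trace = (B * P).trace := by
    rw [hP, trace_mul_comm, ← Matrix.mul_assoc, hPP, trace_mul_comm]
  have h1 : (P * B * Pᴴ).trace = 0 := by
    have h2 := Complex.nonneg_iff.1 h.trace_nonneg
    apply Complex.ext
    · rw [ht, h0]; rfl
    · rw [← h2.2]; rfl
  have h3 : P * B * Pᴴ = 0 := h.trace_eq_zero_iff.1 h1
  rw [hP] at h3
  have h4 : ∀ v : Fin n → ℂ, B.mulVec (P.mulVec v) = 0 := by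
    intro v
    rw [← hB.dotProduct_mulVec_zero_iff, star_mulVec, hP, ← dotProduct_mulVec, mulVec_mulVec,
      mulVec_mulVec, h3]
    simp
  have h5 : A * P = 0 := by
    refine Matrix.ext_of_mulVec_single fun i => ?_
    rw [← mulVec_mulVec, hker _ (h4 _), zero_mulVec]
  simp [h5]

theorem sum_overlap {A B : Matrix (Fin n) (Fin n) ℂ} (hA : A.IsHermitian) (hB : B.IsHermitian)
    (f : ℝ → ℝ) : (cfc f A).trace.re = ∑ b, ∑ a, f (hA.eigenvalues a) * overlap hA hB b a := by
  have h := trace_cfc_mul_cfc hA hB f (fun _ => 1)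
  rw [cfc_const_one ℝ B, Matrix.mul_one] at h
  simpa using h

/-- The indicator `e` of `{0}` gives the projection `e(B)` onto `ker B`, so `A e(B) = 0`. Its trace
is a sum of nonnegative terms, each of which must vanish. -/
theorem eigenvalue_ne_zero_of_ker_le {A B : Matrix (Fin n) (Fin n) ℂ} (hA : A.PosSemidef)
    (hB : B.PosSemidef) (hker : ∀ v : Fin n → ℂ, B.mulVec v = 0 → A.mulVec v = 0) (b a : Fin n)
    (h : overlap hA.1 hB.1 b a * hA.1.eigenvalues a ≠ 0) : hB.1.eigenvalues b ≠ 0 := by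
  intro hb
  apply h
  let e : ℝ → ℝ := fun x => if x = 0 then 1 else 0
  have hcB := continuousOn_spectrum B
  have hBs : IsSelfAdjoint B := hB.1
  have h1 : B * cfc e B = 0 := by
    have : cfc (fun x => x * e x) B = B * cfc e B := by
      rw [cfc_mul (fun x => x) e B (hcB _) (hcB _), cfc_id' ℝ B]
    rw [← this]
    have : (fun x : ℝ => x * e x) = fun _ => 0 := by
      ext x
      by_cases hx : x = 0 <;> simp [e, hx]
    rw [this, cfc_const_zero]
  have h2 : A * cfc e B = 0 := by
    refine Matrix.ext_of_mulVec_single fun i => ?_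
    rw [← mulVec_mulVec, hker _ (by rw [mulVec_mulVec, h1, zero_mulVec]), zero_mulVec]
  have h3 := trace_cfc_mul_cfc hA.1 hB.1 (fun x => x) e
  rw [cfc_id_eq hA.1, h2] at h3
  simp only [trace_zero, Complex.zero_re] at h3
  have nn : ∀ b a, 0 ≤ e (hB.1.eigenvalues b) * hA.1.eigenvalues a * overlap hA.1 hB.1 b a := by
    intro b a
    refine mul_nonneg (mul_nonneg ?_ (hA.eigenvalues_nonneg a)) (overlap_nonneg _ _ _ _)
    simp only [e]; split_ifs <;> norm_num
  have h4 := (Finset.sum_eq_zero_iff_of_nonneg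
    (fun b _ => Finset.sum_nonneg fun a _ => nn b a)).1 h3.symm b (Finset.mem_univ _)
  have h5 := (Finset.sum_eq_zero_iff_of_nonneg (fun a _ => nn b a)).1 h4 a (Finset.mem_univ _)
  simp only [e, hb, if_true, one_mul] at h5
  rw [mul_comm]; exact h5

/-- The divergence (in nats) of the binary distributions `(r, 1 - r)` and `(s, 1 - s)`, for
supports that are contained in each other. -/
noncomputable def klBin (r s : ℝ) : ℝ :=
  r * (Real.log r - Real.log s) + (1 - r) * (Real.log (1 - r) - Real.log (1 - s))

/-- Expanding `tr A log A` over both eigenbases too puts the divergence in classical form, comparing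
the weights `overlap * p a` with `overlap * q b`. -/
theorem trace_mul_log_sub {A B : Matrix (Fin n) (Fin n) ℂ} (hA : A.IsHermitian)
    (hB : B.IsHermitian) :
    (A * cfc (Real.logb 2) A - A * cfc (Real.logb 2) B).trace.re =
      (∑ k : Fin n × Fin n, overlap hA hB k.1 k.2 * hA.eigenvalues k.2 *
        (Real.log (hA.eigenvalues k.2) - Real.log (hB.eigenvalues k.1))) / Real.log 2 := by
  have h1 : A * cfc (Real.logb 2) A = cfc (fun x => x * Real.logb 2 x) A := by
    rw [cfc_mul (fun x => x) _ A (continuousOn_spectrum _ _) (continuousOn_spectrum _ _),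
      cfc_id_eq hA]
  have h2 := trace_cfc_mul_cfc hA hB (fun x => x) (Real.logb 2)
  rw [cfc_id_eq hA] at h2
  rw [trace_sub, Complex.sub_re, h2, h1, sum_overlap hA hB, ← Finset.sum_sub_distrib,
    Fintype.sum_prod_type, Finset.sum_div]
  refine Finset.sum_congr rfl fun b _ => ?_
  rw [← Finset.sum_sub_distrib, Finset.sum_div]
  refine Finset.sum_congr rfl fun a _ => ?_
  simp only [Real.logb]
  ring

theorem klBin_trace_le {ρ σ P : Matrix (Fin n) (Fin n) ℂ} (hρ : IsState ρ) (hσ : IsState σ)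
    (hP : Pᴴ = P) (hPP : P * P = P)
    (hker : ∀ v : Fin n → ℂ, σ.mulVec v = 0 → ρ.mulVec v = 0) :
    klBin (ρ * P).trace.re (σ * P).trace.re / Real.log 2 ≤
      (ρ * cfc (Real.logb 2) ρ - ρ * cfc (Real.logb 2) σ).trace.re := by
  have hQ : (1 - P)ᴴ = 1 - P := by simp [hP]
  have hQQ : (1 - P) * (1 - P) = 1 - P := by
    simp [Matrix.mul_sub, Matrix.sub_mul, hPP]
  have hPQ : P * (1 - P) = 0 := by simp [Matrix.mul_sub, hPP]
  have hQP : (1 - P) * P = 0 := by simp [Matrix.sub_mul, hPP]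
  have hρQ : (ρ * (1 - P)).trace.re = 1 - (ρ * P).trace.re := by
    simp [Matrix.mul_sub, trace_sub, hρ.2]
  have hσQ : (σ * (1 - P)).trace.re = 1 - (σ * P).trace.re := by
    simp [Matrix.mul_sub, trace_sub, hσ.2]
  have hx1 := trace_conj_nonneg hρ.1 hP hPP
  have hx2 := trace_conj_nonneg hρ.1 hQ hQQ
  have hy1 := trace_conj_nonneg hσ.1 hP hPP
  have hy2 := trace_conj_nonneg hσ.1 hQ hQQ
  have hz1 := trace_mul_projection_eq_zero hσ.1 hP hPP hker
  have hz2 := trace_mul_projection_eq_zero hσ.1 hQ hQQ hker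
  rw [hρQ] at hx2 hz2
  rw [hσQ] at hy2 hz2
  set r := (ρ * P).trace.re with hr
  set t := (σ * P).trace.re with ht
  rw [trace_mul_log_sub hρ.1.1 hσ.1.1]
  refine div_le_div_of_nonneg_right ?_ (Real.log_nonneg (by norm_num))
  have key := sum_mul_log_sub_log_le (κ := Fin 2) (v := fun _ => 1) (x := ![r, 1 - r])
    (y := ![t, 1 - t]) (w := fun k : Fin n × Fin n => overlap hρ.1.1 hσ.1.1 k.1 k.2)
    (p := fun k => hρ.1.1.eigenvalues k.2) (q := fun k => hσ.1.1.eigenvalues k.1)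
    (fun k => hρ.1.eigenvalues_nonneg _) (fun k => hσ.1.eigenvalues_nonneg _)
    (by simp [Fin.forall_fin_two, hx1, hx2]) (by simp [Fin.forall_fin_two, hy1, hy2])
    (fun k => eigenvalue_ne_zero_of_ker_le hρ.1 hσ.1 hker k.1 k.2)
    (by
      simp only [Fin.forall_fin_two, one_mul, Matrix.cons_val_zero, Matrix.cons_val_one]
      exact ⟨fun h h' => h (hz1 h'), fun h h' => h (hz2 h')⟩)
    (by
      have h := sum_overlap hρ.1.1 hσ.1.1 (fun x => x)
      have h' : ρ.trace.re = 1 := by rw [hρ.2]; rfl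
      rw [cfc_id_eq hρ.1.1, h', ← Fintype.sum_prod_type'] at h
      simp only [Fin.sum_univ_two, one_mul, Matrix.cons_val_zero, Matrix.cons_val_one,
        mul_comm (overlap _ _ _ _)]
      rw [← h]; simp)
    (fun s hs => by
      -- `c` and `d` maximize `2 c r - c² (t + s r)` and its complement; the maxima are the two
      -- binary resolvent terms.
      set c := r / (t + s * r) with hc
      set d := (1 - r) / ((1 - t) + s * (1 - r)) with hd
      have h := two_mul_trace_sub_le hρ.1 hσ.1 (Y := (c : ℂ) • P + (d : ℂ) • (1 - P))
        (by rw [conjTranspose_add, conjTranspose_smul, conjTranspose_smul, hP, hQ]; simp) hs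
      have hYY : ((c : ℂ) • P + (d : ℂ) • (1 - P)) * ((c : ℂ) • P + (d : ℂ) • (1 - P)) =
          ((c ^ 2 : ℝ) : ℂ) • P + ((d ^ 2 : ℝ) : ℂ) • (1 - P) := by
        rw [Matrix.add_mul, Matrix.mul_add, Matrix.mul_add]
        simp only [Matrix.smul_mul, Matrix.mul_smul, hPP, hQQ, hPQ, hQP, smul_zero, smul_smul,
          add_zero, zero_add]
        push_cast
        rw [sq, sq]
      have htr : ∀ (A : Matrix (Fin n) (Fin n) ℂ) (u v : ℝ),
          (A * ((u : ℂ) • P + (v : ℂ) • (1 - P))).trace.re =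
            u * (A * P).trace.re + v * (A * (1 - P)).trace.re := by
        intro A u v
        rw [Matrix.mul_add, Matrix.mul_smul, Matrix.mul_smul, trace_add, trace_smul, trace_smul]
        simp
      rw [hYY, htr, htr, htr, hρQ, hσQ, ← hr, ← ht, ← Fintype.sum_prod_type'] at h
      refine le_trans (le_of_eq ?_) h
      simp only [Fin.sum_univ_two, one_mul, Matrix.cons_val_zero, Matrix.cons_val_one]
      have sq_div_eq : ∀ x y : ℝ, 0 ≤ x → 0 ≤ y →
          x ^ 2 / (y + s * x) = 2 * (x / (y + s * x) * x) - (x / (y + s * x)) ^ 2 * (y + s * x) := by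
        intro x y hx hy
        rcases (add_nonneg hy (mul_nonneg hs.le hx)).eq_or_lt with h0 | h0
        · simp [← h0]
        · field_simp; ring
      rw [sq_div_eq r t hx1 hy1, sq_div_eq (1 - r) (1 - t) hx2 hy2]
      ring)
  simpa [klBin] using key

end

section

open Matrix

/-! ### Binary states -/

/-- Interpolating `f` at the diagonal entries by a polynomial replaces the functional calculus by
polynomial evaluation, which commutes with the algebra map `diagonal`. -/
theorem cfc_diagonal {n : ℕ} (d : Fin n → ℝ) (f : ℝ → ℝ) :
    cfc f (diagonal fun i => (d i : ℂ)) = diagonal fun i => (f (d i) : ℂ) := by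
  have hs : IsSelfAdjoint (diagonal fun i => (d i : ℂ)) := by
    rw [isSelfAdjoint_iff, star_eq_conjTranspose, diagonal_conjTranspose]
    congr 1; ext i; simp
  let q := Lagrange.interpolate (Finset.univ.image d) id f
  have hq : ∀ i, q.eval (d i) = f (d i) := fun i =>
    Lagrange.eval_interpolate_at_node (v := id) f (Set.injOn_id _)
      (Finset.mem_image_of_mem d (Finset.mem_univ i))
  have hspec : spectrum ℝ (diagonal fun i => (d i : ℂ)) ⊆ Set.range d := by
    intro x hx
    rw [← spectrum.algebraMap_mem_iff ℂ] at hx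
    rw [spectrum_diagonal] at hx
    obtain ⟨i, hi⟩ := hx
    exact ⟨i, by simpa using hi⟩
  rw [cfc_congr (g := q.eval) (fun x hx => by obtain ⟨i, rfl⟩ := hspec hx; exact (hq i).symm)]
  rw [cfc_polynomial q _ hs]
  have h1 := Polynomial.aeval_algHom_apply (Matrix.diagonalAlgHom (n := Fin n) (α := ℂ) ℝ) (fun i => (d i : ℂ)) q
  have h2 : Polynomial.aeval (fun i => (d i : ℂ)) q = fun i => (f (d i) : ℂ) := by
    ext i
    have := (Polynomial.aeval_algHom_apply (Pi.evalAlgHom ℝ (fun _ : Fin n => ℂ) i) (fun i => (d i : ℂ)) q).symm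
    simp only [Pi.evalAlgHom_apply] at this
    rw [this, ← hq i]
    simpa using Polynomial.aeval_algebraMap_apply ℂ (d i) q
  rw [h2] at h1
  exact h1

theorem isHermitian_diagonal_ofReal {n : ℕ} (d : Fin n → ℝ) :
    (diagonal fun i => (d i : ℂ)).IsHermitian := by
  rw [IsHermitian, diagonal_conjTranspose]
  congr 1; ext i; simp

theorem binaryState_eq (r : ℝ) :
    binaryState r = diagonal fun i => ((![r, 1 - r] i : ℝ) : ℂ) := by
  unfold binaryState
  congr 1
  ext i
  fin_cases i <;> simp

theorem isState_binaryState {r : ℝ} (h0 : 0 ≤ r) (h1 : r ≤ 1) : IsState (binaryState r) := by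
  rw [binaryState_eq]
  refine ⟨Matrix.PosSemidef.diagonal fun i => ?_, ?_⟩
  · fin_cases i
    · simpa using h0
    · simpa [← Complex.ofReal_one, ← Complex.ofReal_sub] using h1
  · simp [trace_diagonal]

theorem traceDist_binaryState (r s : ℝ) :
    traceDist (binaryState r) (binaryState s) = |r - s| := by
  have h : binaryState r - binaryState s =
      diagonal fun i => ((![r - s, s - r] i : ℝ) : ℂ) := by
    rw [binaryState_eq, binaryState_eq, diagonal_sub]
    congr 1
    ext i
    fin_cases i <;> simp
  have hs := (isHermitian_diagonal_ofReal ![r - s, s - r]).isSelfAdjoint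
  have habs := CFC.abs_eq_cfc_norm _ (ha := hs)
  rw [traceDist, h, habs, cfc_diagonal, trace_diagonal]
  simp [abs_sub_comm s r]
  ring

open Classical in
theorem umegakiBin_eq (r s : ℝ) : umegakiBin r s =
    if (s = 0 → r = 0) ∧ (1 - s = 0 → 1 - r = 0) then
      ((klBin r s / Real.log 2 : ℝ) : EReal) else ⊤ := by
  unfold umegakiBin umegakiDiv
  have hiff : (∀ v : Fin 2 → ℂ, (binaryState s).mulVec v = 0 → (binaryState r).mulVec v = 0) ↔
      (s = 0 → r = 0) ∧ (1 - s = 0 → 1 - r = 0) := by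
    have hz : ∀ (u : ℝ) (v : Fin 2 → ℂ), (binaryState u).mulVec v = 0 ↔
        ((u : ℂ) * v 0 = 0 ∧ ((1 - u : ℝ) : ℂ) * v 1 = 0) := by
      intro u v
      rw [funext_iff, Fin.forall_fin_two, binaryState_eq, mulVec_diagonal, mulVec_diagonal]
      rfl
    simp only [hz, mul_eq_zero, Complex.ofReal_eq_zero]
    constructor
    · intro h
      constructor
      · intro hs
        simpa using (h ![1, 0] (by simp [hs])).1
      · intro hs
        simpa using (h ![0, 1] (by simp [hs])).2
    · rintro ⟨h1, h2⟩ v ⟨h3, h4⟩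
      exact ⟨h3.imp_left h1, h4.imp_left h2⟩
  simp only [hiff]
  congr 2
  rw [binaryState_eq, binaryState_eq, cfc_diagonal, cfc_diagonal, diagonal_mul_diagonal,
    diagonal_mul_diagonal, diagonal_sub, trace_diagonal]
  simp only [← Complex.ofReal_mul, ← Complex.ofReal_sub, ← Complex.ofReal_sum, Complex.ofReal_re,
    Fin.sum_univ_two, Matrix.cons_val_zero, Matrix.cons_val_one, Real.logb, klBin]
  ring

/-- Measuring along the positive part of `ρ - σ` reduces to binary states. -/
theorem exists_umegakiBin_le {n : ℕ} {ρ σ : Matrix (Fin n) (Fin n) ℂ} (hρ : IsState ρ)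
    (hσ : IsState σ) : ∃ r ∈ Icc (0 : ℝ) 1, ∃ s ∈ Icc (0 : ℝ) 1, traceDist ρ σ = r - s ∧
      umegakiBin r s ≤ umegakiDiv ρ σ := by
  obtain ⟨P, hP, hPP, hT⟩ := exists_projection_traceDist hρ hσ
  have hQ : (1 - P)ᴴ = 1 - P := by simp [hP]
  have hQQ : (1 - P) * (1 - P) = 1 - P := by
    simp [Matrix.mul_sub, Matrix.sub_mul, hPP]
  have hQt : ∀ {A : Matrix (Fin n) (Fin n) ℂ}, IsState A →
      (A * (1 - P)).trace.re = 1 - (A * P).trace.re := by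
    intro A hA
    simp [Matrix.mul_sub, trace_sub, hA.2]
  have hmem : ∀ {A : Matrix (Fin n) (Fin n) ℂ}, IsState A → (A * P).trace.re ∈ Icc (0 : ℝ) 1 := by
    intro A hA
    refine ⟨trace_conj_nonneg hA.1 hP hPP, ?_⟩
    have := trace_conj_nonneg hA.1 hQ hQQ
    rw [hQt hA] at this
    linarith
  refine ⟨_, hmem hρ, _, hmem hσ, hT, ?_⟩
  unfold umegakiDiv
  split_ifs with hker
  · rw [umegakiBin_eq, if_pos]
    · exact EReal.coe_le_coe_iff.2 (klBin_trace_le hρ hσ hP hPP hker)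
    · refine ⟨trace_mul_projection_eq_zero hσ.1 hP hPP hker, ?_⟩
      rw [← hQt hσ, ← hQt hρ]
      exact trace_mul_projection_eq_zero hσ.1 hQ hQQ hker
  · exact le_top

end

section

/-! ### The scalar optimization problem -/

/-- One term of Gibbs' inequality: summed over `(r, s)` and `(1 - r, 1 - s)`, the left sides cancel.
-/
theorem sub_le_mul_log_sub {x y : ℝ} (hx : 0 ≤ x) (hy : 0 ≤ y) (hxy : y = 0 → x = 0) :
    x - y ≤ x * (Real.log x - Real.log y) := by
  rcases hx.eq_or_lt with rfl | hx
  · simpa using hy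
  · have hy : 0 < y := lt_of_le_of_ne hy fun h => hx.ne' (hxy h.symm)
    have h := Real.log_le_sub_one_of_pos (div_pos hy hx)
    rw [Real.log_div hy.ne' hx.ne'] at h
    have := mul_le_mul_of_nonneg_left h hx.le
    rw [mul_sub, mul_sub, mul_div_cancel₀ _ hx.ne'] at this
    linarith

theorem sub_lt_mul_log_sub {x y : ℝ} (hx : 0 ≤ x) (hy : 0 ≤ y) (hxy : y = 0 → x = 0)
    (hne : x ≠ y) : x - y < x * (Real.log x - Real.log y) := by
  rcases hx.eq_or_lt with rfl | hx
  · simpa using lt_of_le_of_ne hy hne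
  · have hy : 0 < y := lt_of_le_of_ne hy fun h => hx.ne' (hxy h.symm)
    have h := Real.log_lt_sub_one_of_pos (div_pos hy hx) (by rw [ne_eq, div_eq_one_iff_eq hx.ne']; exact hne.symm)
    rw [Real.log_div hy.ne' hx.ne'] at h
    have := mul_lt_mul_of_pos_left h hx
    rw [mul_sub, mul_sub, mul_div_cancel₀ _ hx.ne'] at this
    linarith

theorem klBin_nonneg {r s : ℝ} (hr : r ∈ Icc (0 : ℝ) 1) (hs : s ∈ Icc (0 : ℝ) 1)
    (h0 : s = 0 → r = 0) (h1 : 1 - s = 0 → 1 - r = 0) : 0 ≤ klBin r s := by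
  have := sub_le_mul_log_sub hr.1 hs.1 h0
  have := sub_le_mul_log_sub (sub_nonneg.2 hr.2) (sub_nonneg.2 hs.2) h1
  unfold klBin
  linarith

theorem klBin_pos {r s : ℝ} (hr : r ∈ Icc (0 : ℝ) 1) (hs : s ∈ Icc (0 : ℝ) 1)
    (h0 : s = 0 → r = 0) (h1 : 1 - s = 0 → 1 - r = 0) (hne : r ≠ s) : 0 < klBin r s := by
  have := sub_lt_mul_log_sub hr.1 hs.1 h0 hne
  have := sub_le_mul_log_sub (sub_nonneg.2 hr.2) (sub_nonneg.2 hs.2) h1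
  unfold klBin
  linarith

/-- The ratio `a / (eᵃ - 1)`. -/
noncomputable def expRatio (a : ℝ) : ℝ := a / (Real.exp a - 1)

/-- First coordinate of the minimizer of `klBin r s - a (r - s)`. -/
noncomputable def minR (a : ℝ) : ℝ :=
  Real.exp a * (Real.exp a - 1 - a) / (Real.exp a - 1) ^ 2

/-- Second coordinate of the minimizer of `klBin r s - a (r - s)`. -/
noncomputable def minS (a : ℝ) : ℝ := 1 / a - 1 / (Real.exp a - 1)

section

variable {a : ℝ}

/-! ### Identities for the minimizer and the Gibbs variational bound -/

theorem add_one_lt_exp_pos (ha : 0 < a) : 0 < Real.exp a - 1 - a := by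
  have := Real.add_one_lt_exp ha.ne'
  linarith

theorem exp_sub_one_pos (ha : 0 < a) : 0 < Real.exp a - 1 := by
  have := add_one_lt_exp_pos ha
  linarith

theorem one_sub_exp_add_pos (ha : 0 < a) : 0 < 1 - Real.exp a + a * Real.exp a := by
  have h := Real.add_one_lt_exp (neg_ne_zero.2 ha.ne')
  have h2 := mul_lt_mul_of_pos_right h (Real.exp_pos a)
  rw [← Real.exp_add, neg_add_cancel, Real.exp_zero] at h2
  linarith

theorem expRatio_pos (ha : 0 < a) : 0 < expRatio a := div_pos ha (exp_sub_one_pos ha)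

theorem expRatio_lt_one (ha : 0 < a) : expRatio a < 1 := by
  rw [expRatio, div_lt_one (exp_sub_one_pos ha)]
  have := add_one_lt_exp_pos ha
  linarith

theorem minS_eq (ha : 0 < a) : minS a = (Real.exp a - 1 - a) / (a * (Real.exp a - 1)) := by
  have := (exp_sub_one_pos ha).ne'
  unfold minS
  field_simp

/-- Together with `one_sub_minR`: the minimizing `r` is the exponential tilt of the minimizing `s`,
with likelihood ratios `eᵃ β` and `β`, where `β = expRatio a`. -/
theorem minR_eq (ha : 0 < a) : minR a = minS a * Real.exp a * expRatio a := by
  have := (exp_sub_one_pos ha).ne'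
  rw [minS_eq ha, expRatio, minR]
  field_simp

theorem one_sub_minR (ha : 0 < a) : 1 - minR a = (1 - minS a) * expRatio a := by
  have := (exp_sub_one_pos ha).ne'
  rw [minS_eq ha, expRatio, minR]
  field_simp
  ring

theorem mul_minS (ha : 0 < a) : a * minS a = 1 - expRatio a := by
  have := (exp_sub_one_pos ha).ne'
  rw [minS, expRatio]
  field_simp

theorem minR_sub_minS (ha : 0 < a) : minR a - minS a =
    (Real.exp a - 1 - a) * (1 - Real.exp a + a * Real.exp a) / ((Real.exp a - 1) ^ 2 * a) := by
  have := (exp_sub_one_pos ha).ne'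
  rw [minS_eq ha, minR]
  field_simp
  ring

/-- The stationarity condition in `s`. It recovers `a` from the minimizer, which `curveT_injOn`
needs. -/
theorem minR_sub_minS_eq_mul (ha : 0 < a) : minR a - minS a = a * (minS a * (1 - minS a)) := by
  have := (exp_sub_one_pos ha).ne'
  rw [minS_eq ha, minR]
  field_simp
  ring

theorem minS_pos (ha : 0 < a) : 0 < minS a := by
  rw [minS_eq ha]
  exact div_pos (add_one_lt_exp_pos ha) (mul_pos ha (exp_sub_one_pos ha))

theorem minS_lt_minR (ha : 0 < a) : minS a < minR a := by
  rw [← sub_pos, minR_sub_minS ha]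
  have := add_one_lt_exp_pos ha
  have := exp_sub_one_pos ha
  have := one_sub_exp_add_pos ha
  positivity

theorem one_sub_minR_eq (ha : 0 < a) :
    1 - minR a = (1 - Real.exp a + a * Real.exp a) / (Real.exp a - 1) ^ 2 := by
  have := (exp_sub_one_pos ha).ne'
  rw [minR]
  field_simp
  ring

theorem minR_lt_one (ha : 0 < a) : minR a < 1 := by
  rw [← sub_pos, one_sub_minR_eq ha]
  have := exp_sub_one_pos ha
  have := one_sub_exp_add_pos ha
  positivity

theorem continuousAt_minR (ha : 0 < a) : ContinuousAt minR a := by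
  unfold minR
  exact ContinuousAt.div (by fun_prop) (by fun_prop) (pow_ne_zero 2 (exp_sub_one_pos ha).ne')

theorem continuousAt_minS (ha : 0 < a) : ContinuousAt minS a := by
  unfold minS
  exact (ContinuousAt.div (by fun_prop) (by fun_prop) ha.ne').sub
    (ContinuousAt.div (by fun_prop) (by fun_prop) (exp_sub_one_pos ha).ne')

theorem log_minR_sub_log_minS (ha : 0 < a) :
    Real.log (minR a) - Real.log (minS a) = a + Real.log (expRatio a) := by
  rw [minR_eq ha, Real.log_mul (mul_pos (minS_pos ha) (Real.exp_pos a)).ne' (expRatio_pos ha).ne',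
    Real.log_mul (minS_pos ha).ne' (Real.exp_pos a).ne', Real.log_exp]
  ring

theorem log_one_sub_minR_sub (ha : 0 < a) :
    Real.log (1 - minR a) - Real.log (1 - minS a) = Real.log (expRatio a) := by
  have := (minS_lt_minR ha).trans (minR_lt_one ha)
  rw [one_sub_minR ha, Real.log_mul (by linarith) (expRatio_pos ha).ne']
  ring

theorem klBin_min (ha : 0 < a) :
    klBin (minR a) (minS a) - a * (minR a - minS a) = Real.log (expRatio a) + 1 - expRatio a := by
  rw [klBin, log_minR_sub_log_minS ha, log_one_sub_minR_sub ha]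
  linear_combination mul_minS ha

/-- Gibbs' variational principle: the reference distribution is tilted by `(eᵃ, 1)`, and `1 + s (eᵃ
- 1)` is its normalizing constant. -/
theorem klBin_sub_mul_eq {r s : ℝ} (ha : 0 < a) (hs : s ∈ Icc (0 : ℝ) 1)
    (h0 : s = 0 → r = 0) (h1 : 1 - s = 0 → 1 - r = 0) :
    klBin r s - a * r + Real.log (1 + s * (Real.exp a - 1)) =
      klBin r (s * Real.exp a / (1 + s * (Real.exp a - 1))) := by
  have he := exp_sub_one_pos ha
  have hZ : 0 < 1 + s * (Real.exp a - 1) := by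
    have := mul_nonneg hs.1 he.le
    linarith
  have e1 : 1 - s * Real.exp a / (1 + s * (Real.exp a - 1)) =
      (1 - s) / (1 + s * (Real.exp a - 1)) := by
    field_simp; ring
  have t1 : r * Real.log (s * Real.exp a / (1 + s * (Real.exp a - 1))) =
      r * (Real.log s + a - Real.log (1 + s * (Real.exp a - 1))) := by
    by_cases h : s = 0
    · simp [h0 h]
    · rw [Real.log_div (mul_ne_zero h (Real.exp_pos a).ne') hZ.ne',
        Real.log_mul h (Real.exp_pos a).ne', Real.log_exp]
  have t2 : (1 - r) * Real.log ((1 - s) / (1 + s * (Real.exp a - 1))) =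
      (1 - r) * (Real.log (1 - s) - Real.log (1 + s * (Real.exp a - 1))) := by
    by_cases h : 1 - s = 0
    · simp [h1 h]
    · rw [Real.log_div h hZ.ne']
  rw [klBin, klBin, e1, mul_sub, mul_sub r (Real.log r) (Real.log (_ / _)), t1,
    mul_sub (1 - r) (Real.log (1 - r)) (Real.log (_ / _)), t2]
  ring

theorem le_klBin_sub {r s : ℝ} (ha : 0 < a) (hr : r ∈ Icc (0 : ℝ) 1) (hs : s ∈ Icc (0 : ℝ) 1)
    (h0 : s = 0 → r = 0) (h1 : 1 - s = 0 → 1 - r = 0) :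
    Real.log (expRatio a) + 1 - expRatio a ≤ klBin r s - a * (r - s) ∧
      ((r, s) ≠ (minR a, minS a) →
        Real.log (expRatio a) + 1 - expRatio a < klBin r s - a * (r - s)) := by
  have he := exp_sub_one_pos ha
  have hb := expRatio_pos ha
  set Z := 1 + s * (Real.exp a - 1) with hZ
  have hZ0 : 0 < Z := by
    have := mul_nonneg hs.1 he.le
    linarith
  have hbZ : expRatio a * Z = expRatio a + a * s := by
    rw [expRatio, hZ]; field_simp
  set u := s * Real.exp a / Z with hu
  have hu1 : 1 - u = (1 - s) / Z := by
    rw [hu]; field_simp; rw [hZ]; ring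
  have hum : u ∈ Icc (0 : ℝ) 1 := by
    refine ⟨by have := hs.1; positivity, ?_⟩
    rw [← sub_nonneg, hu1]
    exact div_nonneg (sub_nonneg.2 hs.2) hZ0.le
  have hu0 : u = 0 → r = 0 := fun h => h0 (by
    rw [hu, div_eq_zero_iff] at h
    simpa [hZ0.ne', (Real.exp_pos a).ne'] using h)
  have hu2 : 1 - u = 0 → 1 - r = 0 := fun h => h1 (by
    rw [hu1, div_eq_zero_iff] at h
    simpa [hZ0.ne'] using h)
  have hk := klBin_sub_mul_eq ha hs h0 h1
  rw [← hZ, ← hu] at hk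
  have hlog : Real.log (expRatio a * Z) = Real.log (expRatio a) + Real.log Z :=
    Real.log_mul hb.ne' hZ0.ne'
  -- The objective is `klBin r u + a s - log Z`. The first term is nonnegative, and `log (β Z) ≤ β Z
  -- - 1 = β + a s - 1` bounds the rest. Equality forces `β Z = 1`, that is `s = minS a`, and then
  -- `r = u = minR a`.
  have g1 := klBin_nonneg hr hum hu0 hu2
  have g2 := Real.log_le_sub_one_of_pos (mul_pos hb hZ0)
  refine ⟨by linarith, fun hne => ?_⟩
  by_cases hs' : s = minS a
  · have hr' : r ≠ minR a := fun h => hne (by rw [h, hs'])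
    have hur : u = minR a := by
      have : expRatio a * Z = 1 := by
        rw [hbZ, hs', mul_minS ha]; ring
      rw [minR_eq ha, hu, ← hs', div_eq_iff hZ0.ne', mul_assoc, this, mul_one]
    have := klBin_pos hr hum hu0 hu2 (by rwa [hur])
    linarith
  · have h2 : expRatio a * Z ≠ 1 := by
      intro h
      apply hs'
      have := mul_minS ha
      apply mul_left_cancel₀ ha.ne'
      linarith
    have := Real.log_lt_sub_one_of_pos (mul_pos hb hZ0) h2
    linarith

end

/-! ### Pinsker's inequality for binary distributions -/

theorem hasDerivAt_klBin {r u : ℝ} (h0 : 0 < u) (h1 : u < 1) :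
    HasDerivAt (fun u => klBin r u - 2 * (r - u) ^ 2)
      (-((r - u) * (1 - 2 * u) ^ 2 / (u * (1 - u)))) u := by
  have hu : (1 - u) ≠ 0 := by linarith
  have d1 := ((Real.hasDerivAt_log h0.ne').const_sub (Real.log r)).const_mul r
  have d2 := ((((hasDerivAt_id u).const_sub 1).log hu).const_sub (Real.log (1 - r))).const_mul (1 - r)
  have d3 := (((hasDerivAt_id u).const_sub r).pow 2).const_mul 2
  refine ((d1.add d2).sub d3).congr_deriv ?_
  simp only [id]
  have := h0.ne'
  field_simp
  ring

/-- The derivative contains `(1 - 2u)²`, so strictness is obtained on intervals without `1/2` in the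
interior; `two_mul_sq_lt_klBin` splits there. -/
theorem klBin_pinsker_strictAntiOn {r s t : ℝ} (hs : 0 < s) (ht : t ≤ r) (hr : r < 1)
    (hhalf : t ≤ 1 / 2 ∨ 1 / 2 ≤ s) :
    StrictAntiOn (fun u => klBin r u - 2 * (r - u) ^ 2) (Icc s t) := by
  refine strictAntiOn_of_deriv_neg (convex_Icc s t) ?_ ?_
  · intro u hu
    exact (hasDerivAt_klBin (hs.trans_le hu.1)
      ((hu.2.trans ht).trans_lt hr)).continuousAt.continuousWithinAt
  · intro u hu
    rw [interior_Icc] at hu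
    have h0 := hs.trans hu.1
    have h1 := hu.2.trans_le ht
    rw [(hasDerivAt_klBin h0 (h1.trans hr)).deriv, neg_lt_zero]
    have h2 : 1 - 2 * u ≠ 0 := by
      rcases hhalf with h | h
      · have := hu.2; intro h'; linarith
      · have := hu.1; intro h'; linarith
    have h3 : 0 < 1 - u := by linarith
    have h4 : 0 < r - u := by linarith
    positivity

theorem two_mul_sq_lt_klBin {r s : ℝ} (hs : 0 < s) (hsr : s < r) (hr : r < 1) :
    2 * (r - s) ^ 2 < klBin r s := by
  have h0 : klBin r r - 2 * (r - r) ^ 2 = 0 := by simp [klBin]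
  by_cases h : s < 1 / 2 ∧ 1 / 2 < r
  · have h1 := klBin_pinsker_strictAntiOn hs h.2.le hr (Or.inl le_rfl) (left_mem_Icc.2 h.1.le)
      (right_mem_Icc.2 h.1.le) h.1
    have h2 := klBin_pinsker_strictAntiOn (s := 1 / 2) (by norm_num) le_rfl hr (Or.inr le_rfl)
      (left_mem_Icc.2 h.2.le) (right_mem_Icc.2 h.2.le) h.2
    simp only at h1 h2
    linarith
  · have h1 := klBin_pinsker_strictAntiOn hs le_rfl hr
      (by rw [not_and_or, not_lt, not_lt] at h; exact h.symm) (left_mem_Icc.2 hsr.le)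
      (right_mem_Icc.2 hsr.le) hsr
    simp only at h1
    linarith

/-! ### Limits of the minimizer -/

theorem tendsto_exp_sub_one_div :
    Tendsto (fun a => (Real.exp a - 1) / a) (𝓝[>] 0) (𝓝 1) := by
  have h := (Real.hasDerivAt_exp 0).tendsto_slope_zero_right
  simpa [div_eq_inv_mul] using h

theorem tendsto_exp_sub_one_sub_div_sq :
    Tendsto (fun a => (Real.exp a - 1 - a) / a ^ 2) (𝓝[>] 0) (𝓝 (1 / 2)) := by
  have hid : Tendsto (fun a : ℝ => a) (𝓝[>] 0) (𝓝 0) := tendsto_id.mono_left nhdsWithin_le_nhds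
  have h0 : Tendsto (fun a : ℝ => 1 / 2 - a) (𝓝[>] 0) (𝓝 (1 / 2)) := by
    simpa only [sub_zero] using hid.const_sub (1 / 2)
  have h1 : Tendsto (fun a : ℝ => 1 / 2 + a) (𝓝[>] 0) (𝓝 (1 / 2)) := by
    simpa only [add_zero] using hid.const_add (1 / 2)
  have key : ∀ᶠ a : ℝ in 𝓝[>] 0, |(Real.exp a - 1 - a) / a ^ 2 - 1 / 2| ≤ a := by
    filter_upwards [Ioc_mem_nhdsGT (zero_lt_one' ℝ)] with a ha
    have hb := Real.exp_bound (x := a) (by rw [abs_of_pos ha.1]; exact ha.2) (n := 3) (by norm_num)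
    simp only [Finset.sum_range_succ, Finset.sum_range_zero, abs_of_pos ha.1] at hb
    norm_num [Nat.factorial] at hb
    have e : (Real.exp a - 1 - a) / a ^ 2 - 1 / 2 = (Real.exp a - (1 + a + a ^ 2 / 2)) / a ^ 2 := by
      have := ha.1.ne'
      field_simp
      ring
    rw [e, abs_div, abs_of_pos (pow_pos ha.1 2), div_le_iff₀ (pow_pos ha.1 2)]
    have := pow_pos ha.1 3
    nlinarith
  refine tendsto_of_tendsto_of_tendsto_of_le_of_le' h0 h1 ?_ ?_
  · filter_upwards [key] with a ha
    linarith [(abs_le.1 ha).1]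
  · filter_upwards [key] with a ha
    linarith [(abs_le.1 ha).2]

theorem tendsto_minS_zero : Tendsto minS (𝓝[>] 0) (𝓝 (1 / 2)) := by
  have h := tendsto_exp_sub_one_sub_div_sq.div tendsto_exp_sub_one_div one_ne_zero
  rw [div_one] at h
  refine h.congr' ?_
  filter_upwards [self_mem_nhdsWithin] with a ha
  have := (exp_sub_one_pos ha).ne'
  have := (mem_Ioi.1 ha).ne'
  simp only [Pi.div_apply]
  rw [minS_eq ha]
  field_simp

theorem tendsto_expRatio_zero : Tendsto expRatio (𝓝[>] 0) (𝓝 1) := by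
  have h := tendsto_exp_sub_one_div.inv₀ one_ne_zero
  rw [inv_one] at h
  exact h.congr fun a => by rw [inv_div, expRatio]

theorem tendsto_minR_zero : Tendsto minR (𝓝[>] 0) (𝓝 (1 / 2)) := by
  have he : Tendsto Real.exp (𝓝[>] 0) (𝓝 1) := by
    simpa using (Real.continuous_exp.tendsto 0).mono_left nhdsWithin_le_nhds
  have h := (tendsto_minS_zero.mul he).mul tendsto_expRatio_zero
  rw [mul_one, mul_one] at h
  refine h.congr' ?_
  filter_upwards [self_mem_nhdsWithin] with a ha
  rw [minR_eq ha]

theorem tendsto_minS_atTop : Tendsto minS atTop (𝓝 0) := by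
  have h : Tendsto (fun a => Real.exp a - 1) atTop atTop :=
    tendsto_atTop_add_const_right _ _ Real.tendsto_exp_atTop
  have h2 := tendsto_inv_atTop_zero.sub h.inv_tendsto_atTop
  rw [sub_zero] at h2
  exact h2.congr fun a => by simp [minS]

theorem tendsto_minR_atTop : Tendsto minR atTop (𝓝 1) := by
  have h1 : Tendsto (fun a => Real.exp (-a)) atTop (𝓝 0) := Real.tendsto_exp_neg_atTop_nhds_zero
  have h2 : Tendsto (fun a => a * Real.exp (-a)) atTop (𝓝 0) := by
    simpa using Real.tendsto_pow_mul_exp_neg_atTop_nhds_zero 1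
  have h3 := ((h1.const_sub 1).sub h2).div ((h1.const_sub 1).pow 2) (by norm_num)
  norm_num at h3
  refine h3.congr' ?_
  filter_upwards [eventually_gt_atTop 0] with a ha
  have := (exp_sub_one_pos ha).ne'
  have h4 := (Real.exp_pos a).ne'
  simp only [Pi.div_apply]
  rw [minR, Real.exp_neg]
  have h5 : 1 - (Real.exp a)⁻¹ = (Real.exp a - 1) / Real.exp a := by field_simp
  rw [h5]
  field_simp

end

section

/-! ### The curve in terms of the minimizer -/

theorem log_two_pos : 0 < Real.log 2 := Real.log_pos one_lt_two

theorem two_rpow_eq (t : ℝ) : (2 : ℝ) ^ t = Real.exp (t * Real.log 2) := by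
  rw [Real.rpow_def_of_pos two_pos, mul_comm]

theorem mul_log_two_pos {t : ℝ} (ht : 0 < t) : 0 < t * Real.log 2 := mul_pos ht log_two_pos

theorem rStar_eq {t : ℝ} (ht : 0 < t) : rStar t = minR (t * Real.log 2) := by
  rw [rStar, if_neg ht.ne', two_rpow_eq, minR]

theorem sStar_eq {t : ℝ} (ht : 0 < t) : sStar t = minS (t * Real.log 2) := by
  rw [sStar, if_neg ht.ne', two_rpow_eq, minS, ← neg_sub (Real.exp _) 1, one_div_neg_eq_neg_one_div]
  ring

theorem rStar_zero : rStar 0 = 1 / 2 := if_pos rfl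

theorem sStar_zero : sStar 0 = 1 / 2 := if_pos rfl

theorem curveT_eq {t : ℝ} (ht : 0 ≤ t) : curveT t = rStar t - sStar t := by
  rcases ht.eq_or_lt with rfl | ht
  · simp [curveT, rStar_zero, sStar_zero]
  · rw [rStar_eq ht, sStar_eq ht, minR_sub_minS (mul_log_two_pos ht), curveT, if_neg ht.ne',
      two_rpow_eq, Real.log_exp]
    ring_nf

theorem sStar_pos {t : ℝ} (ht : 0 ≤ t) : 0 < sStar t := by
  rcases ht.eq_or_lt with rfl | ht
  · norm_num [sStar_zero]
  · rw [sStar_eq ht]; exact minS_pos (mul_log_two_pos ht)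

theorem sStar_lt_rStar {t : ℝ} (ht : 0 < t) : sStar t < rStar t := by
  rw [rStar_eq ht, sStar_eq ht]; exact minS_lt_minR (mul_log_two_pos ht)

theorem sStar_le_rStar {t : ℝ} (ht : 0 ≤ t) : sStar t ≤ rStar t := by
  rcases ht.eq_or_lt with rfl | ht
  · rw [rStar_zero, sStar_zero]
  · exact (sStar_lt_rStar ht).le

theorem rStar_lt_one {t : ℝ} (ht : 0 ≤ t) : rStar t < 1 := by
  rcases ht.eq_or_lt with rfl | ht
  · norm_num [rStar_zero]
  · rw [rStar_eq ht]; exact minR_lt_one (mul_log_two_pos ht)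

theorem rStar_mem {t : ℝ} (ht : 0 ≤ t) : rStar t ∈ Icc (0 : ℝ) 1 :=
  ⟨((sStar_pos ht).trans_le (sStar_le_rStar ht)).le, (rStar_lt_one ht).le⟩

theorem sStar_mem {t : ℝ} (ht : 0 ≤ t) : sStar t ∈ Icc (0 : ℝ) 1 :=
  ⟨(sStar_pos ht).le, (sStar_le_rStar ht).trans (rStar_lt_one ht).le⟩

theorem curveD_eq {t : ℝ} (ht : 0 ≤ t) : curveD t = klBin (rStar t) (sStar t) / Real.log 2 := by
  rcases ht.eq_or_lt with rfl | ht
  · simp [curveD, klBin, rStar_zero, sStar_zero]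
  · have ha := mul_log_two_pos ht
    have hl := log_two_pos
    rw [rStar_eq ht, sStar_eq ht, klBin, log_minR_sub_log_minS ha, log_one_sub_minR_sub ha,
      one_sub_minR_eq ha, curveD, if_neg ht.ne', two_rpow_eq, Real.log_exp, minR]
    set a := t * Real.log 2 with hadef
    have he := exp_sub_one_pos ha
    -- Since `a = t ln 2`, this conversion is the source of the summand `log (ln 2)` in `curveD`.
    have hlog : Real.log (expRatio a) = Real.log (t / (Real.exp a - 1)) + Real.log (Real.log 2) := by
      rw [← Real.log_mul (div_pos ht he).ne' hl.ne', expRatio, hadef]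
      congr 1
      ring
    have hlog' : Real.log (Real.exp a * t / (Real.exp a - 1)) =
        a + Real.log (t / (Real.exp a - 1)) := by
      rw [mul_div_assoc, Real.log_mul (Real.exp_pos a).ne' (div_pos ht he).ne', Real.log_exp]
    simp only [Real.logb]
    rw [hlog, hlog']
    generalize Real.log (t / (Real.exp a - 1)) = x
    generalize Real.log (Real.log 2) = y
    have := he.ne'
    field_simp
    ring

theorem logb_prod_eq {r s : ℝ} (hs : 0 < s) (hs1 : s < 1) (hr : 0 < r) (hr1 : r < 1) :
    Real.logb 2 ((r / s) ^ r * ((1 - r) / (1 - s)) ^ (1 - r)) = klBin r s / Real.log 2 := by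
  have h1 : 0 < 1 - r := by linarith
  have h2 : 0 < 1 - s := by linarith
  rw [Real.logb, Real.log_mul (by positivity) (by positivity), Real.log_rpow (by positivity),
    Real.log_rpow (by positivity), Real.log_div hr.ne' hs.ne', Real.log_div h1.ne' h2.ne', klBin]

theorem umegakiBin_star {t : ℝ} (ht : 0 ≤ t) :
    umegakiBin (rStar t) (sStar t) = ((curveD t : ℝ) : EReal) := by
  have h1 := sStar_pos ht
  have h2 := (sStar_le_rStar ht).trans_lt (rStar_lt_one ht)
  rw [umegakiBin_eq, if_pos, curveD_eq ht]
  exact ⟨fun h => absurd h h1.ne', fun h => absurd h (by linarith)⟩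

theorem traceDist_star {t : ℝ} (ht : 0 ≤ t) :
    traceDist (binaryState (rStar t)) (binaryState (sStar t)) = curveT t := by
  rw [traceDist_binaryState, abs_of_nonneg (sub_nonneg.2 (sStar_le_rStar ht)), curveT_eq ht]

theorem isState_rStar {t : ℝ} (ht : 0 ≤ t) : IsState (binaryState (rStar t)) :=
  isState_binaryState (rStar_mem ht).1 (rStar_mem ht).2

theorem isState_sStar {t : ℝ} (ht : 0 ≤ t) : IsState (binaryState (sStar t)) :=
  isState_binaryState (sStar_mem ht).1 (sStar_mem ht).2

/-! ### The linear bound -/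

theorem curveD_sub_eq {t : ℝ} (ht : 0 < t) : (curveD t - t * curveT t) * Real.log 2 =
    Real.log (expRatio (t * Real.log 2)) + 1 - expRatio (t * Real.log 2) := by
  have := log_two_pos.ne'
  rw [← klBin_min (mul_log_two_pos ht), curveD_eq ht.le, curveT_eq ht.le, rStar_eq ht, sStar_eq ht]
  field_simp

theorem curveD_sub_le {t r s : ℝ} (ht : 0 ≤ t) (hr : r ∈ Icc (0 : ℝ) 1) (hs : s ∈ Icc (0 : ℝ) 1) :
    ((curveD t - t * curveT t : ℝ) : EReal) ≤ umegakiBin r s - ((t * (r - s) : ℝ) : EReal) := by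
  have hl := log_two_pos
  rw [umegakiBin_eq]
  split_ifs with h
  · rw [← EReal.coe_sub, EReal.coe_le_coe_iff]
    rcases ht.eq_or_lt with rfl | ht
    · have := div_nonneg (klBin_nonneg hr hs h.1 h.2) hl.le
      simpa [curveD, curveT] using this
    · have := (le_klBin_sub (mul_log_two_pos ht) hr hs h.1 h.2).1
      rw [← curveD_sub_eq ht] at this
      refine le_of_mul_le_mul_right (this.trans_eq ?_) hl
      field_simp
  · rw [EReal.top_sub_coe]; exact le_top

theorem curveD_sub_lt {t r s : ℝ} (ht : 0 < t) (hr : r ∈ Icc (0 : ℝ) 1) (hs : s ∈ Icc (0 : ℝ) 1)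
    (hne : (r, s) ≠ (rStar t, sStar t)) :
    ((curveD t - t * curveT t : ℝ) : EReal) < umegakiBin r s - ((t * (r - s) : ℝ) : EReal) := by
  have hl := log_two_pos
  rw [umegakiBin_eq]
  split_ifs with h
  · rw [← EReal.coe_sub, EReal.coe_lt_coe_iff]
    have := (le_klBin_sub (mul_log_two_pos ht) hr hs h.1 h.2).2 (by rwa [← rStar_eq ht, ← sStar_eq ht])
    rw [← curveD_sub_eq ht] at this
    refine lt_of_mul_lt_mul_right (this.trans_eq ?_) hl.le
    field_simp
  · rw [EReal.top_sub_coe]; exact EReal.coe_lt_top _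

theorem umegakiLinearBound_le (lam : ℝ) {n : ℕ} {ρ σ : Matrix (Fin n) (Fin n) ℂ} (hρ : IsState ρ)
    (hσ : IsState σ) :
    umegakiLinearBound lam ≤ umegakiDiv ρ σ - ((lam * traceDist ρ σ : ℝ) : EReal) :=
  iInf_le_of_le n <| iInf_le_of_le ρ <| iInf_le_of_le σ <| iInf_le_of_le hρ <| iInf_le _ hσ

theorem umegakiLinearBound_le_curve (lam : ℝ) {t : ℝ} (ht : 0 ≤ t) :
    umegakiLinearBound lam ≤ ((curveD t - lam * curveT t : ℝ) : EReal) := by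
  have h := umegakiLinearBound_le lam (isState_rStar ht) (isState_sStar ht)
  rwa [← umegakiBin, umegakiBin_star ht, traceDist_star ht, ← EReal.coe_sub] at h

theorem umegakiLinearBound_eq {lam : ℝ} (h : 0 ≤ lam) :
    umegakiLinearBound lam = ((curveD lam - lam * curveT lam : ℝ) : EReal) := by
  refine le_antisymm (umegakiLinearBound_le_curve lam h) ?_
  refine le_iInf fun n => le_iInf fun ρ => le_iInf fun σ => le_iInf fun hρ => le_iInf fun hσ => ?_
  obtain ⟨r, hr, s, hs, hT, hle⟩ := exists_umegakiBin_le hρ hσ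
  rw [hT]
  exact (curveD_sub_le h hr hs).trans (EReal.sub_le_sub hle le_rfl)

theorem curveT_pos {t : ℝ} (ht : 0 < t) : 0 < curveT t := by
  rw [curveT_eq ht.le]; exact sub_pos.2 (sStar_lt_rStar ht)

theorem curveT_nonneg {t : ℝ} (ht : 0 ≤ t) : 0 ≤ curveT t := by
  rw [curveT_eq ht]; exact sub_nonneg.2 (sStar_le_rStar ht)

/-- A single test pair at positive trace distance, here the curve point `t = 1`, already forces the
limit. -/
theorem tendsto_umegakiLinearBound : Tendsto umegakiLinearBound atTop (𝓝 ⊥) := by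
  have h : Tendsto (fun lam : ℝ => curveD 1 - lam * curveT 1) atTop atBot :=
    tendsto_atBot_add_const_left _ (curveD 1)
      (tendsto_neg_atTop_atBot.comp (tendsto_id.atTop_mul_const (curveT_pos one_pos)))
  exact tendsto_of_tendsto_of_tendsto_of_le_of_le tendsto_const_nhds
    (EReal.tendsto_coe_nhds_bot_iff.2 h) (fun _ => bot_le)
    (fun lam => umegakiLinearBound_le_curve lam zero_le_one)

/-! ### The convex bound -/

theorem umegakiConvexBound_le {n : ℕ} {ρ σ : Matrix (Fin n) (Fin n) ℂ} (hρ : IsState ρ)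
    (hσ : IsState σ) : umegakiConvexBound (traceDist ρ σ) ≤ umegakiDiv ρ σ :=
  iSup_le fun lam => EReal.add_le_of_le_sub (umegakiLinearBound_le lam hρ hσ)

theorem le_umegakiConvexBound {lam : ℝ} (h : 0 ≤ lam) (T : ℝ) :
    ((curveD lam - lam * curveT lam + lam * T : ℝ) : EReal) ≤ umegakiConvexBound T := by
  refine le_iSup_of_le lam ?_
  rw [umegakiLinearBound_eq h, EReal.coe_add]

/-- The states at parameter `t` bound every slope from above, including negative ones; the line of
slope `t` attains this bound. -/
theorem umegakiConvexBound_curve {t : ℝ} (ht : 0 ≤ t) :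
    umegakiConvexBound (curveT t) = ((curveD t : ℝ) : EReal) := by
  refine le_antisymm ?_ ?_
  · have h := umegakiConvexBound_le (isState_rStar ht) (isState_sStar ht)
    rwa [← umegakiBin, umegakiBin_star ht, traceDist_star ht] at h
  · simpa using le_umegakiConvexBound ht (curveT t)

/-- Equal trace distances give equal values of the convex bound, so both curve points minimize the
same linear objective. Uniqueness makes them coincide, and stationarity returns the slope. -/
theorem curveT_injOn : InjOn curveT (Ici 0) := by
  intro t ht u hu h
  rcases (mem_Ici.1 ht).eq_or_lt with h0 | ht0
  · rcases (mem_Ici.1 hu).eq_or_lt with h1 | hu0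
    · rw [← h0, ← h1]
    · have := curveT_pos hu0
      rw [← h, ← h0, curveT, if_pos rfl] at this
      exact absurd this (lt_irrefl _)
  rcases (mem_Ici.1 hu).eq_or_lt with h1 | hu0
  · have := curveT_pos ht0
    rw [h, ← h1, curveT, if_pos rfl] at this
    exact absurd this (lt_irrefl _)
  have hD : curveD t = curveD u := by
    have := umegakiConvexBound_curve ht
    rw [h, umegakiConvexBound_curve hu, EReal.coe_eq_coe_iff] at this
    exact this.symm
  have heq : (rStar u, sStar u) = (rStar t, sStar t) := by
    by_contra hne
    have := curveD_sub_lt ht0 (rStar_mem hu) (sStar_mem hu) hne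
    rw [umegakiBin_star hu, ← curveT_eq hu, h, hD] at this
    exact lt_irrefl _ (by exact_mod_cast this)
  have hs : sStar u = sStar t := congrArg Prod.snd heq
  have hs0 := sStar_pos ht
  have hs1 := (sStar_le_rStar ht).trans_lt (rStar_lt_one ht)
  have e1 := minR_sub_minS_eq_mul (mul_log_two_pos ht0)
  have e2 := minR_sub_minS_eq_mul (mul_log_two_pos hu0)
  rw [← rStar_eq ht0, ← sStar_eq ht0, ← curveT_eq ht] at e1
  rw [← rStar_eq hu0, ← sStar_eq hu0, ← curveT_eq hu, hs, ← h, e1] at e2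
  have hpos : 0 < sStar t * (1 - sStar t) := mul_pos hs0 (by linarith)
  exact mul_right_cancel₀ log_two_pos.ne' (mul_right_cancel₀ hpos.ne' e2)

/-! ### Limits and continuity along the curve -/

theorem tendsto_mul_log_two_zero :
    Tendsto (fun t : ℝ => t * Real.log 2) (𝓝[>] 0) (𝓝[>] 0) := by
  refine tendsto_nhdsWithin_iff.2 ⟨?_, ?_⟩
  · have : Tendsto (fun t : ℝ => t * Real.log 2) (𝓝 0) (𝓝 (0 * Real.log 2)) :=
      tendsto_id.mul_const _
    rw [zero_mul] at this
    exact this.mono_left nhdsWithin_le_nhds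
  · filter_upwards [self_mem_nhdsWithin] with t ht
    exact mul_log_two_pos ht

theorem tendsto_rStar_zero : Tendsto rStar (𝓝[>] 0) (𝓝 (rStar 0)) := by
  rw [rStar_zero]
  refine (tendsto_minR_zero.comp tendsto_mul_log_two_zero).congr' ?_
  filter_upwards [self_mem_nhdsWithin] with t ht
  exact (rStar_eq ht).symm

theorem tendsto_sStar_zero : Tendsto sStar (𝓝[>] 0) (𝓝 (sStar 0)) := by
  rw [sStar_zero]
  refine (tendsto_minS_zero.comp tendsto_mul_log_two_zero).congr' ?_
  filter_upwards [self_mem_nhdsWithin] with t ht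
  exact (sStar_eq ht).symm

theorem tendsto_curveT_zero : Tendsto curveT (𝓝[>] 0) (𝓝 (curveT 0)) := by
  rw [curveT_eq le_rfl]
  refine (tendsto_rStar_zero.sub tendsto_sStar_zero).congr' ?_
  filter_upwards [self_mem_nhdsWithin] with t ht
  exact (curveT_eq (mem_Ioi.1 ht).le).symm

theorem tendsto_curveD_zero : Tendsto curveD (𝓝[>] 0) (𝓝 (curveD 0)) := by
  rw [curveD_eq le_rfl]
  have hr := tendsto_rStar_zero
  have hs := tendsto_sStar_zero
  have hr1 := hr.const_sub 1
  have hs1 := hs.const_sub 1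
  have h : Tendsto (fun t => klBin (rStar t) (sStar t) / Real.log 2) (𝓝[>] 0)
      (𝓝 (klBin (rStar 0) (sStar 0) / Real.log 2)) := by
    unfold klBin
    refine ((hr.mul ((hr.log ?_).sub (hs.log ?_))).add
      (hr1.mul ((hr1.log ?_).sub (hs1.log ?_)))).div_const _ <;>
    norm_num [rStar_zero, sStar_zero]
  refine h.congr' ?_
  filter_upwards [self_mem_nhdsWithin] with t ht
  exact (curveD_eq (mem_Ioi.1 ht).le).symm

theorem tendsto_curveT_atTop : Tendsto curveT atTop (𝓝 1) := by
  have hm : Tendsto (fun t : ℝ => t * Real.log 2) atTop atTop :=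
    tendsto_id.atTop_mul_const log_two_pos
  have h := (tendsto_minR_atTop.comp hm).sub (tendsto_minS_atTop.comp hm)
  rw [sub_zero] at h
  refine h.congr' ?_
  filter_upwards [eventually_gt_atTop 0] with t ht
  rw [curveT_eq ht.le, rStar_eq ht, sStar_eq ht]
  rfl

theorem continuousOn_curveT : ContinuousOn curveT (Ici 0) := by
  intro t ht
  rcases (mem_Ici.1 ht).eq_or_lt with rfl | ht
  · exact continuousWithinAt_Ioi_iff_Ici.1 tendsto_curveT_zero
  · have hc : ContinuousAt (fun u : ℝ => minR (u * Real.log 2) - minS (u * Real.log 2)) t := by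
      have ha := mul_log_two_pos ht
      have hm : ContinuousAt (fun u : ℝ => u * Real.log 2) t :=
        continuousAt_id.mul continuousAt_const
      exact ((continuousAt_minR ha).comp (f := fun u : ℝ => u * Real.log 2) hm).sub
        ((continuousAt_minS ha).comp (f := fun u : ℝ => u * Real.log 2) hm)
    refine (hc.congr ?_).continuousWithinAt
    filter_upwards [lt_mem_nhds ht] with u hu
    rw [curveT_eq hu.le, rStar_eq hu, sStar_eq hu]

theorem bijOn_curveT : BijOn curveT (Ici 0) (Ico 0 1) := by
  refine ⟨fun t ht => ⟨curveT_nonneg ht, ?_⟩, curveT_injOn, fun T hT => ?_⟩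
  · rw [curveT_eq ht]
    linarith [rStar_lt_one ht, sStar_pos ht]
  · obtain ⟨u, hu0, hu⟩ := ((eventually_ge_atTop (0 : ℝ)).and
      (tendsto_curveT_atTop.eventually (lt_mem_nhds hT.2))).exists
    have h0 : curveT 0 = 0 := if_pos rfl
    obtain ⟨t, ht, rfl⟩ := intermediate_value_Icc hu0
      (continuousOn_curveT.mono Icc_subset_Ici_self) ⟨h0.trans_le hT.1, hu.le⟩
    exact ⟨t, ht.1, rfl⟩

theorem exists_curveT_eq {T : ℝ} (hT : T ∈ Ico (0 : ℝ) 1) : ∃ t, 0 ≤ t ∧ curveT t = T :=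
  bijOn_curveT.surjOn hT

/-- Affine minorants that exceed any bound at distance `1`. -/
theorem exists_lt_linear_at_one (M : ℝ) :
    ∃ lam : ℝ, 0 ≤ lam ∧ M < curveD lam - lam * curveT lam + lam := by
  have hl := log_two_pos
  have h : Tendsto (fun lam : ℝ => Real.log (lam * Real.log 2)) atTop atTop :=
    Real.tendsto_log_atTop.comp (tendsto_id.atTop_mul_const hl)
  obtain ⟨lam, h0, h1⟩ := ((eventually_gt_atTop (0 : ℝ)).and
    (h.eventually_gt_atTop (M * Real.log 2))).exists
  refine ⟨lam, h0.le, lt_of_mul_lt_mul_right (h1.trans ?_) hl.le⟩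
  have ha := mul_log_two_pos h0
  rw [add_mul, curveD_sub_eq h0]
  have hb := expRatio_lt_one ha
  have he := exp_sub_one_pos ha
  rw [show Real.log (expRatio (lam * Real.log 2)) = Real.log (lam * Real.log 2) -
    Real.log (Real.exp (lam * Real.log 2) - 1) from Real.log_div ha.ne' he.ne']
  -- With `a = lam * log 2` the value at distance `1`, in nats, is `log a + (a - log (eᵃ - 1)) + (1
  -- - β)`, which exceeds `log a`.
  have := Real.log_lt_log he (sub_one_lt (Real.exp (lam * Real.log 2)))
  rw [Real.log_exp] at this
  linarith

theorem umegakiConvexBound_one : umegakiConvexBound 1 = ⊤ := by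
  refine EReal.eq_top_iff_forall_lt _ |>.2 fun M => ?_
  obtain ⟨lam, h0, h⟩ := exists_lt_linear_at_one M
  refine lt_of_lt_of_le ?_ (le_umegakiConvexBound h0 1)
  rw [mul_one]
  exact EReal.coe_lt_coe_iff.2 h

theorem tendsto_umegakiConvexBound_one : Tendsto umegakiConvexBound (𝓝[<] 1) (𝓝 ⊤) := by
  rw [EReal.tendsto_nhds_top_iff_real]
  intro M
  obtain ⟨lam, h0, h⟩ := exists_lt_linear_at_one M
  have hc : Tendsto (fun T : ℝ => curveD lam - lam * curveT lam + lam * T) (𝓝[<] 1)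
      (𝓝 (curveD lam - lam * curveT lam + lam * 1)) :=
    ((tendsto_id.const_mul lam).const_add _).mono_left nhdsWithin_le_nhds
  rw [mul_one] at hc
  filter_upwards [hc.eventually (lt_mem_nhds h)] with T hT
  exact (EReal.coe_lt_coe_iff.2 hT).trans_le (le_umegakiConvexBound h0 T)

theorem le_toReal_umegakiConvexBound {lam T : ℝ} (h : 0 ≤ lam) (hT : T ∈ Ico (0 : ℝ) 1) :
    curveD lam - lam * curveT lam + lam * T ≤ (umegakiConvexBound T).toReal := by
  obtain ⟨t, ht, rfl⟩ := exists_curveT_eq hT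
  have := le_umegakiConvexBound h (curveT t)
  rw [umegakiConvexBound_curve ht] at this ⊢
  exact EReal.coe_le_coe_iff.1 this

/-- The supporting line at the intermediate point lies below the bound at both endpoints. -/
theorem convexOn_umegakiConvexBound :
    ConvexOn ℝ (Ico 0 1) (fun T : ℝ => (umegakiConvexBound T).toReal) := by
  refine ⟨convex_Ico 0 1, fun x hx y hy α β hα hβ hαβ => ?_⟩
  obtain ⟨t, ht, hT⟩ := exists_curveT_eq (convex_Ico (0 : ℝ) 1 hx hy hα hβ hαβ)
  have h1 := mul_le_mul_of_nonneg_left (le_toReal_umegakiConvexBound ht hx) hα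
  have h2 := mul_le_mul_of_nonneg_left (le_toReal_umegakiConvexBound ht hy) hβ
  simp only [smul_eq_mul] at hT ⊢
  rw [← hT, umegakiConvexBound_curve ht, EReal.toReal_coe]
  refine le_trans (le_of_eq ?_) (add_le_add h1 h2)
  linear_combination (-(curveD t - t * curveT t)) * hαβ + t * hT

theorem isLeast_umegakiConvexBound {T : ℝ} (hT : T ∈ Icc (0 : ℝ) 1) :
    IsLeast {d : EReal | ∃ (n : ℕ) (ρ σ : Matrix (Fin n) (Fin n) ℂ),
      IsState ρ ∧ IsState σ ∧ traceDist ρ σ = T ∧ umegakiDiv ρ σ = d} (umegakiConvexBound T) := by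
  refine ⟨?_, ?_⟩
  · rcases hT.2.eq_or_lt with rfl | h1
    -- Orthogonal pure states: the kernel condition fails, so the infinite value is attained.
    · refine ⟨2, binaryState 1, binaryState 0, isState_binaryState zero_le_one le_rfl,
        isState_binaryState le_rfl zero_le_one, by simp [traceDist_binaryState], ?_⟩
      rw [← umegakiBin, umegakiBin_eq, if_neg (by simp), umegakiConvexBound_one]
    · obtain ⟨t, ht, rfl⟩ := exists_curveT_eq ⟨hT.1, h1⟩
      exact ⟨2, _, _, isState_rStar ht, isState_sStar ht, traceDist_star ht,
        (umegakiBin_star ht).trans (umegakiConvexBound_curve ht).symm⟩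
  · rintro _ ⟨n, ρ, σ, hρ, hσ, rfl, rfl⟩
    exact umegakiConvexBound_le hρ hσ

theorem pinsker_lt_umegakiConvexBound {T : ℝ} (hT : T ∈ Ioc (0 : ℝ) 1) :
    ((2 / Real.log 2 * T ^ 2 : ℝ) : EReal) < umegakiConvexBound T := by
  rcases hT.2.eq_or_lt with rfl | h1
  · rw [umegakiConvexBound_one]; exact EReal.coe_lt_top _
  · obtain ⟨t, ht, rfl⟩ := exists_curveT_eq ⟨hT.1.le, h1⟩
    rw [umegakiConvexBound_curve ht, EReal.coe_lt_coe_iff, curveD_eq ht,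
      lt_div_iff₀ log_two_pos, curveT_eq ht]
    have h0 := hT.1
    rw [curveT_eq ht, sub_pos] at h0
    refine lt_of_eq_of_lt ?_ (two_mul_sq_lt_klBin (sStar_pos ht) h0 (rStar_lt_one ht))
    have := log_two_pos.ne'
    field_simp

end

end Umegaki

theorem mainTheorem5 :
    -- the closed form of the linear bound; the value at `lam = ∞` is the limit
    (∀ lam : ℝ, 0 ≤ lam →
      umegakiLinearBound lam =
        ((Real.logb 2 ((rStar lam / sStar lam) ^ rStar lam *
            ((1 - rStar lam) / (1 - sStar lam)) ^ (1 - rStar lam))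
          - lam * (rStar lam - sStar lam) : ℝ) : EReal)) ∧
    Tendsto umegakiLinearBound atTop (𝓝 ⊥) ∧
    -- it is the value of the objective at `(rStar, sStar)`
    (∀ lam : ℝ, 0 ≤ lam →
      0 < sStar lam ∧ sStar lam ≤ rStar lam ∧ rStar lam < 1 ∧
      umegakiBin (rStar lam) (sStar lam) - ((lam * (rStar lam - sStar lam) : ℝ) : EReal) =
        umegakiLinearBound lam) ∧
    -- for `lam > 0` that point is the only minimizer on the unit square, and it is interior
    (∀ lam : ℝ, 0 < lam → sStar lam < rStar lam ∧
      ∀ r ∈ Icc (0 : ℝ) 1, ∀ s ∈ Icc (0 : ℝ) 1, (r, s) ≠ (rStar lam, sStar lam) →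
        umegakiBin (rStar lam) (sStar lam) - ((lam * (rStar lam - sStar lam) : ℝ) : EReal) <
          umegakiBin r s - ((lam * (r - s) : ℝ) : EReal)) ∧
    -- the values at parameter `0` are the limits of the formulas
    (Tendsto rStar (𝓝[>] 0) (𝓝 (rStar 0)) ∧ Tendsto sStar (𝓝[>] 0) (𝓝 (sStar 0)) ∧
      Tendsto curveT (𝓝[>] 0) (𝓝 (curveT 0)) ∧ Tendsto curveD (𝓝[>] 0) (𝓝 (curveD 0))) ∧
    -- the graph of the convex bound over `[0, 1)` is the parametrized curve
    (∀ t : ℝ, 0 ≤ t → umegakiConvexBound (curveT t) = ((curveD t : ℝ) : EReal)) ∧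
    BijOn curveT (Ici 0) (Ico 0 1) ∧
    -- the points of the curve come from binary jointly diagonal states
    (∀ t : ℝ, 0 ≤ t →
      IsState (binaryState (rStar t)) ∧ IsState (binaryState (sStar t)) ∧
      traceDist (binaryState (rStar t)) (binaryState (sStar t)) = curveT t ∧
      umegakiBin (rStar t) (sStar t) = ((curveD t : ℝ) : EReal)) ∧
    -- the convex bound is a lower bound, it is convex, and it is optimal at every trace distance
    (∀ (n : ℕ) (ρ σ : Matrix (Fin n) (Fin n) ℂ), IsState ρ → IsState σ →
      umegakiConvexBound (traceDist ρ σ) ≤ umegakiDiv ρ σ) ∧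
    ConvexOn ℝ (Ico 0 1) (fun T : ℝ => (umegakiConvexBound T).toReal) ∧
    (∀ T ∈ Icc (0 : ℝ) 1,
      IsLeast {d : EReal | ∃ (n : ℕ) (ρ σ : Matrix (Fin n) (Fin n) ℂ),
          IsState ρ ∧ IsState σ ∧ traceDist ρ σ = T ∧ umegakiDiv ρ σ = d}
        (umegakiConvexBound T)) ∧
    -- it strictly improves Pinsker's bound
    (∀ T ∈ Ioc (0 : ℝ) 1, ((2 / Real.log 2 * T ^ 2 : ℝ) : EReal) < umegakiConvexBound T) ∧
    -- it is finite below `T = 1` and blows up at `T = 1`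
    (∀ T ∈ Ico (0 : ℝ) 1, umegakiConvexBound T < ⊤) ∧
    Tendsto umegakiConvexBound (𝓝[<] 1) (𝓝 ⊤) ∧
    umegakiConvexBound 1 = ⊤ := by
  refine ⟨fun lam h => ?_, Umegaki.tendsto_umegakiLinearBound, fun lam h => ?_, fun lam h => ?_,
    ⟨Umegaki.tendsto_rStar_zero, Umegaki.tendsto_sStar_zero, Umegaki.tendsto_curveT_zero,
      Umegaki.tendsto_curveD_zero⟩, fun t => Umegaki.umegakiConvexBound_curve,
    Umegaki.bijOn_curveT, fun t ht => ⟨Umegaki.isState_rStar ht, Umegaki.isState_sStar ht,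
      Umegaki.traceDist_star ht, Umegaki.umegakiBin_star ht⟩,
    fun n ρ σ => Umegaki.umegakiConvexBound_le, Umegaki.convexOn_umegakiConvexBound,
    fun T => Umegaki.isLeast_umegakiConvexBound,
    fun T => Umegaki.pinsker_lt_umegakiConvexBound, fun T hT => ?_,
    Umegaki.tendsto_umegakiConvexBound_one, Umegaki.umegakiConvexBound_one⟩
  · have hs := Umegaki.sStar_pos h
    have hsr := Umegaki.sStar_le_rStar h
    have hr := Umegaki.rStar_lt_one h
    rw [Umegaki.umegakiLinearBound_eq h, Umegaki.curveD_eq h, Umegaki.curveT_eq h,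
      Umegaki.logb_prod_eq hs (hsr.trans_lt hr) (hs.trans_le hsr) hr]
  · refine ⟨Umegaki.sStar_pos h, Umegaki.sStar_le_rStar h, Umegaki.rStar_lt_one h, ?_⟩
    rw [Umegaki.umegakiBin_star h, Umegaki.umegakiLinearBound_eq h, Umegaki.curveT_eq h,
      ← EReal.coe_sub]
  · refine ⟨Umegaki.sStar_lt_rStar h, fun r hr s hs hne => ?_⟩
    rw [Umegaki.umegakiBin_star h.le, ← EReal.coe_sub, ← Umegaki.curveT_eq h.le]
    exact Umegaki.curveD_sub_lt h hr hs hne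
  · obtain ⟨t, ht, rfl⟩ := Umegaki.exists_curveT_eq hT
    rw [Umegaki.umegakiConvexBound_curve ht]
    exact EReal.coe_lt_top _
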